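/- For a probability distribution $\mu$ on $\{\pm1\}^n$, let $X\sim\mu$, and for $T\subseteq[n]$ put $$A_\mu(T):=\mathbb{E}_{\{i,j\}\sim\binom{[n]}{2}}\ \mathbb{E}_{X_T}\big[\,|\mathrm{Cov}(X_i,X_j\mid X_T)|\,\big],$$ where $X_T=(X_k)_{k\in T}$ and $\{i,j\}$ is a uniformly random pair of distinct indices. Define $$\kappa_*:=\limsup_{t\to\infty}\ \sup_{n\ge t,\ \mu\in\mathcal P(\{\pm1\}^n)}\ \min_{S\subseteq[n],\,|S|\le t}\sqrt t\,A_\mu(S).$$ The Rademacher Sherrington–Kirkpatrick (SK) model on $n$ vertices at inverse temperature $\beta$ is the random distribution $\mu_{n,\beta,J}(x)\propto\exp\big(\frac{\beta}{\sqrt n}\sum_{i<j}J_{ij}x_ix_j\big)$ on $\{\pm1\}^n$, with $J_{ij}$ independent and uniform on $\{\pm1\}$. **Theorem.** 1. There are $\beta\in(0,1/2)$, a constant $C>0$ and integers $t_n\to\infty$ such that, with probability tending to $1$ over $J$ as $n\to\infty$, $A_{\mu_{n,\beta,J}}(T)\ge C/\sqrt{t_n}$ for every $T\subseteq[n]$ with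 $|T|\le t_n$. 2. $\kappa_*\ge\dfrac{1}{16\sqrt{27}}$. 3. The $O(1/\varepsilon^2)$ bound of correlation rounding is tight: there is no function $g$ with $g(\varepsilon)=o(1/\varepsilon^2)$ as $\varepsilon\to0^+$ such that for all $\varepsilon\in(0,1]$, all $n$ and all distributions $\mu$ on $\{\pm1\}^n$ there is an integer $0\le t\le \min(n,g(\varepsilon))$ with $\mathbb{E}_{T\sim\binom{[n]}{t}}[A_\mu(T)]\le\varepsilon$. (For $n\le 1$, where there are no pairs, $A_\mu:=0$.) 4. In particular the Allen–O'Donnell–Zhou conjecture, which asserts this property for $g(\varepsilon)=K/\varepsilon$ with some absolute constant $K$, is false. -/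

import Mathlib

open Filter Topology Asymptotics

noncomputable section

namespace CorrRounding

/-- The hypercube `{±1}^n`. A probability distribution on it is an element of
`stdSimplex ℝ (Cube n)`, that is, a real probability vector `μ`. -/
abbrev Cube (n : ℕ) : Type := Fin n → ℤˣ

/-- The value `±1` of the `i`-th spin, as a real number. -/
def spin {n : ℕ} (x : Cube n) (i : Fin n) : ℝ := ((x i : ℤ) : ℝ)

/-- The unordered pairs of distinct indices, listed as `i < j`. -/
abbrev Pair (n : ℕ) : Type := {p : Fin n × Fin n // p.1 < p.2}

/-- The event `X_T = x_T`: all configurations that agree with `x` on `T`. -/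
def agree {n : ℕ} (T : Finset (Fin n)) (x : Cube n) : Finset (Cube n) :=
  Finset.univ.filter fun y => ∀ k ∈ T, y k = x k

/-- The conditional expectation `E[f(X) | X_T = x_T]` for `X ∼ μ`. It is only used at points `x`
that are weighted by `μ x`, so the value where the event has probability `0` is irrelevant. -/
def condExp {n : ℕ} (μ : Cube n → ℝ) (T : Finset (Fin n)) (x : Cube n) (f : Cube n → ℝ) : ℝ :=
  (∑ y ∈ agree T x, μ y * f y) / ∑ y ∈ agree T x, μ y

/-- The conditional covariance `Cov(X_i, X_j | X_T = x_T)` for `X ∼ μ`. -/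
def condCov {n : ℕ} (μ : Cube n → ℝ) (T : Finset (Fin n)) (x : Cube n) (i j : Fin n) : ℝ :=
  condExp μ T x (fun y => spin y i * spin y j)
    - condExp μ T x (fun y => spin y i) * condExp μ T x (fun y => spin y j)

/-- The average of `|Cov(X_i, X_j | X_T)|` over a uniformly random pair `{i, j}` of distinct
indices and over `X ∼ μ`. -/
def avgCondCov {n : ℕ} (μ : Cube n → ℝ) (T : Finset (Fin n)) : ℝ :=
  (∑ p : Pair n, ∑ x : Cube n, μ x * |condCov μ T x p.1.1 p.1.2|) / (n.choose 2 : ℝ)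

/-- `κ_* = limsup_{t → ∞} sup_{n ≥ t, μ} min_{|S| ≤ t} √t · E |Cov(X_i, X_j | X_S)|`. -/
def kappaStar : ENNReal :=
  limsup (fun t : ℕ =>
    ⨆ (n : ℕ) (_ : t ≤ n) (μ : Cube n → ℝ) (_ : μ ∈ stdSimplex ℝ (Cube n)),
      ⨅ (S : Finset (Fin n)) (_ : S.card ≤ t),
        ENNReal.ofReal (Real.sqrt t * avgCondCov μ S)) atTop

/-- The Boltzmann weight of the Rademacher Sherrington–Kirkpatrick model with signs `J` at inverse
temperature `β`: the couplings are `± β / √n`. -/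
def skWeight {n : ℕ} (β : ℝ) (J : Pair n → ℤˣ) (x : Cube n) : ℝ :=
  Real.exp (β / Real.sqrt n *
    ∑ p : Pair n, ((J p : ℤ) : ℝ) * spin x p.1.1 * spin x p.1.2)

/-- The Gibbs measure of the Rademacher Sherrington–Kirkpatrick model. -/
def skGibbs {n : ℕ} (β : ℝ) (J : Pair n → ℤˣ) (x : Cube n) : ℝ :=
  skWeight β J x / ∑ y : Cube n, skWeight β J y

/-- The probability of an event `E` when the signs `J` are independent and uniform on `±1`. -/
def signProb (n : ℕ) (E : (Pair n → ℤˣ) → Prop) : ℝ :=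
  (Nat.card {J : Pair n → ℤˣ // E J} : ℝ) / (Nat.card (Pair n → ℤˣ) : ℝ)

/-- Correlation rounding with at most `g ε` conditionings: for every accuracy `ε` and every
distribution on `{±1}^n` there is `t ≤ g ε` such that conditioning on a uniformly random set of `t`
variables makes the average absolute conditional covariance at most `ε`. -/
def CorrelationRoundingWithin (g : ℝ → ℝ) : Prop :=
  ∀ ε : ℝ, 0 < ε → ε ≤ 1 → ∀ (n : ℕ) (μ : Cube n → ℝ), μ ∈ stdSimplex ℝ (Cube n) →
    ∃ t : ℕ, t ≤ n ∧ (t : ℝ) ≤ g ε ∧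
      (∑ T ∈ Finset.powersetCard t (Finset.univ : Finset (Fin n)), avgCondCov μ T)
        / (n.choose t : ℝ) ≤ ε

/-- The Allen–O'Donnell–Zhou conjecture: `O(1/ε)` conditionings always suffice. -/
def AllenODonnellZhouConjecture : Prop :=
  ∃ K : ℝ, CorrelationRoundingWithin fun ε => K / ε

end CorrRounding

end

/-!
Conditional covariances of Ising models are bounded below by a free energy, for every conditioning
set at once.

Let `μ ∝ exp H` with `H x = ∑_{i<j} B i j x_i x_j`, condition on `X_T = x_T`, and let `m` be the
vector of conditional means. The conditional measure `ν` and the product measure with the same means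
differ in energy by exactly `∑_{i<j} B i j Cov(X_i, X_j | X_T = x_T)`, since `H` is multilinear. The
energy of `ν` is its negative entropy plus `log Z + log ℙ(X_T = x_T)`, and the negative entropy of a
measure with means `m` is at least `|m|² / 2 - n log 2`. If the couplings are below the mean-field
threshold, `H m ≤ |m|² / 2`, the quadratic terms cancel, and averaging over `x_T`, whose entropy is
at most `|T| log 2`, gives
`∑_{i<j} |B i j| E|Cov(X_i, X_j | X_T)| ≥ log Z - n log 2 - |T| log 2`
(`sum_mul_condCov_ge`, `avgCondCov_isingGibbs_ge`). With couplings of order `1 / √n` and a free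
energy gain `log Z - n log 2` of order `n`, the average covariance thus stays of order `1 / √n` under
a small linear number of conditionings.

The free energy gain is bounded below in `log_partition_ge` by a trial measure: the spins in a block
`S` are uniform, and the others are independent in the field exerted by `S`. The gain is governed by
the variances `∑_{i ∈ S} B i j ^ 2` of these fields.

Two families of couplings are used. Bipartite couplings given by Sylvester's Hadamard matrices
are exactly at the mean-field threshold and give an explicit constant; from them follow the bound on
`κ_*` and the statements about correlation rounding. For the Sherrington–Kirkpatrick model both
hypotheses are met at inverse temperature `1 / 40` as soon as the random sign matrix has norm at most
a multiple of `√n`. This holds with high probability (`card_not_netBounded_le`,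
`NetBounded.abs_energy_le`): a Chernoff and union bound handles the integer points of squared length
at most `4 n`, and all other points reduce to these by rounding, because the quadratic form is affine
in each coordinate.
-/

noncomputable section

namespace CorrRounding

/-! ### The Gibbs variational principle -/

/-- **Gibbs variational principle**: the free energy of a probability vector `ν` for the Hamiltonian
`G` is at most the logarithm of the partition function. -/
theorem sum_mul_sub_log_le_log_sum_exp {α : Type*} [Fintype α] {ν : α → ℝ}
    (hν : ν ∈ stdSimplex ℝ α) (G : α → ℝ) :
    ∑ y, ν y * (G y - Real.log (ν y)) ≤ Real.log (∑ y, Real.exp (G y)) := by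
  obtain ⟨h0, h1⟩ := hν
  have hne : Nonempty α := by
    by_contra h
    rw [not_nonempty_iff] at h
    simp at h1
  set Z := ∑ y, Real.exp (G y) with hZ
  have hZpos : 0 < Z := Finset.sum_pos (fun y _ => Real.exp_pos _) Finset.univ_nonempty
  have key : ∀ y, ν y * (G y - Real.log (ν y) - Real.log Z) ≤ Real.exp (G y) / Z - ν y := by
    intro y
    rcases (h0 y).eq_or_lt with h | h
    · rw [← h]; simp; positivity
    · have h2 := Real.log_le_sub_one_of_pos (x := Real.exp (G y) / Z / ν y) (by positivity)
      rw [Real.log_div (by positivity) h.ne', Real.log_div (by positivity) hZpos.ne',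
        Real.log_exp] at h2
      calc ν y * (G y - Real.log (ν y) - Real.log Z)
          ≤ ν y * (Real.exp (G y) / Z / ν y - 1) :=
            mul_le_mul_of_nonneg_left (by linarith) h.le
        _ = _ := by field_simp
  have h3 := Finset.sum_le_sum fun y (_ : y ∈ Finset.univ) => key y
  simp only [mul_sub _ _ (Real.log Z), Finset.sum_sub_distrib, ← Finset.sum_mul,
    ← Finset.sum_div, h1] at h3
  rw [← hZ, div_self hZpos.ne'] at h3
  linarith

/-! ### Sums over the hypercube -/

theorem spin_eq_one_or_neg_one {n : ℕ} (x : Cube n) (i : Fin n) : spin x i = 1 ∨ spin x i = -1 := by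
  unfold spin
  rcases Int.units_eq_one_or (x i) with h | h <;> simp [h]

theorem spin_sq {n : ℕ} (x : Cube n) (i : Fin n) : spin x i ^ 2 = 1 := by
  rcases spin_eq_one_or_neg_one x i with h | h <;> simp [h]

theorem card_cube (n : ℕ) : (Fintype.card (Cube n) : ℝ) = 2 ^ n := by
  simp [Cube]

/-- Fubini for functions that factor over the coordinates. -/
theorem sum_prod_units {ι : Type*} [Fintype ι] [DecidableEq ι] (φ : ι → ℤˣ → ℝ) :
    ∑ x : ι → ℤˣ, ∏ i, φ i (x i) = ∏ i, (φ i 1 + φ i (-1)) := by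
  have h : ∀ i, φ i 1 + φ i (-1) = ∑ s : ℤˣ, φ i s := by
    intro i
    rw [show (Finset.univ : Finset ℤˣ) = {1, -1} from rfl, Finset.sum_pair (by decide)]
  simp only [h]
  rw [Finset.prod_univ_sum, Fintype.piFinset_univ]

theorem sum_exp_sum_mul_spin {n : ℕ} (f : Fin n → ℝ) :
    ∑ x : Cube n, Real.exp (∑ i, f i * spin x i) = ∏ i, (2 * Real.cosh (f i)) := by
  simp only [Real.exp_sum, spin]
  rw [sum_prod_units fun i s => Real.exp (f i * ((s : ℤ) : ℝ))]
  refine Finset.prod_congr rfl fun i _ => ?_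
  rw [Real.cosh_eq]
  simp
  ring

/-- A function that is odd in one coordinate averages to `0`. -/
theorem sum_spin_mul_eq_zero {n : ℕ} (a : Fin n) (g : Cube n → ℝ)
    (hg : ∀ x, g (Function.update x a (-x a)) = g x) : ∑ x : Cube n, spin x a * g x = 0 := by
  have hinv : Function.Involutive fun x : Cube n => Function.update x a (-x a) := by
    intro x; ext i; by_cases h : i = a
    · subst h; simp
    · simp [h]
  have h := Equiv.sum_comp (hinv.toPerm _) fun x => spin x a * g x
  have h2 : ∀ x : Cube n, spin (hinv.toPerm _ x) a * g (hinv.toPerm _ x) = -(spin x a * g x) := by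
    intro x
    simp only [Function.Involutive.coe_toPerm]
    rw [hg]
    simp [spin]
  simp only [h2, Finset.sum_neg_distrib] at h
  linarith

theorem spin_update_of_ne {n : ℕ} (x : Cube n) {a i : Fin n} (h : i ≠ a) (s : ℤˣ) :
    spin (Function.update x a s) i = spin x i := by
  simp [spin, h]

theorem sum_spin_mul_spin {n : ℕ} {i j : Fin n} (h : i ≠ j) :
    ∑ x : Cube n, spin x i * spin x j = 0 :=
  sum_spin_mul_eq_zero i _ fun x => spin_update_of_ne x h.symm _

theorem linear_update {n : ℕ} (c : Fin n → ℝ) {A : Finset (Fin n)} {a : Fin n} (ha : a ∉ A)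
    (x : Cube n) (s : ℤˣ) :
    ∑ i ∈ A, c i * spin (Function.update x a s) i = ∑ i ∈ A, c i * spin x i :=
  Finset.sum_congr rfl fun i hi => by
    rw [spin_update_of_ne x (ne_of_mem_of_not_mem hi ha)]

/-- Second moment of a Rademacher sum. -/
theorem sum_linear_sq {n : ℕ} (c : Fin n → ℝ) (A : Finset (Fin n)) :
    ∑ x : Cube n, (∑ i ∈ A, c i * spin x i) ^ 2 = 2 ^ n * ∑ i ∈ A, c i ^ 2 := by
  induction A using Finset.induction_on with
  | empty => simp
  | insert a A ha ih =>
    have h1 := sum_spin_mul_eq_zero a (fun x => 2 * c a * ∑ i ∈ A, c i * spin x i)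
      fun x => by rw [linear_update c ha]
    have h2 : ∀ x : Cube n, (∑ i ∈ insert a A, c i * spin x i) ^ 2 =
        (∑ i ∈ A, c i * spin x i) ^ 2 + spin x a * (2 * c a * ∑ i ∈ A, c i * spin x i)
          + c a ^ 2 := by
      intro x
      rw [Finset.sum_insert ha]
      linear_combination c a ^ 2 * spin_sq x a
    rw [Finset.sum_congr rfl fun x _ => h2 x]
    simp only [Finset.sum_add_distrib, h1, ih, Finset.sum_const, Finset.card_univ, nsmul_eq_mul,
      card_cube, Finset.sum_insert ha]
    ring

/-- Fourth moment of a Rademacher sum: Khinchin's inequality with the Gaussian constant. -/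
theorem sum_linear_pow_four_le {n : ℕ} (c : Fin n → ℝ) (A : Finset (Fin n)) :
    ∑ x : Cube n, (∑ i ∈ A, c i * spin x i) ^ 4 ≤ 2 ^ n * (3 * (∑ i ∈ A, c i ^ 2) ^ 2) := by
  induction A using Finset.induction_on with
  | empty => simp
  | insert a A ha ih =>
    have h1 := sum_spin_mul_eq_zero a (fun x => 4 * c a * (∑ i ∈ A, c i * spin x i) ^ 3
      + 4 * c a ^ 3 * ∑ i ∈ A, c i * spin x i)
      fun x => by rw [linear_update c ha]
    have h2 : ∀ x : Cube n, (∑ i ∈ insert a A, c i * spin x i) ^ 4 =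
        (∑ i ∈ A, c i * spin x i) ^ 4 + spin x a * (4 * c a * (∑ i ∈ A, c i * spin x i) ^ 3
          + 4 * c a ^ 3 * ∑ i ∈ A, c i * spin x i)
          + 6 * c a ^ 2 * (∑ i ∈ A, c i * spin x i) ^ 2 + c a ^ 4 := by
      intro x
      rw [Finset.sum_insert ha]
      linear_combination (6 * c a ^ 2 * (∑ i ∈ A, c i * spin x i) ^ 2 + c a ^ 4 * (spin x a ^ 2 + 1)
        + 4 * c a ^ 3 * spin x a * (∑ i ∈ A, c i * spin x i)) * spin_sq x a
    rw [Finset.sum_congr rfl fun x _ => h2 x]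
    simp only [Finset.sum_add_distrib, h1, ← Finset.mul_sum, sum_linear_sq, Finset.sum_const,
      Finset.card_univ, nsmul_eq_mul, card_cube, Finset.sum_insert ha]
    have : (0 : ℝ) ≤ 2 ^ n * c a ^ 4 := by positivity
    nlinarith

/-! ### Elementary inequalities for hyperbolic functions -/

theorem sinh_le_mul_cosh {x : ℝ} (hx : 0 ≤ x) : Real.sinh x ≤ x * Real.cosh x := by
  have hm : MonotoneOn (fun y => y * Real.cosh y - Real.sinh y) (Set.Ici 0) := by
    refine monotoneOn_of_hasDerivWithinAt_nonneg (f' := fun y => y * Real.sinh y) (convex_Ici 0)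
      (by fun_prop) (fun y _ => ?_) fun y hy => ?_
    · exact ((((hasDerivAt_id y).mul (Real.hasDerivAt_cosh y)).sub
        (Real.hasDerivAt_sinh y)).congr_deriv (by simp)).hasDerivWithinAt
    · simp only [interior_Ici, Set.mem_Ioi] at hy
      exact mul_nonneg hy.le (Real.sinh_nonneg_iff.2 hy.le)
  have := hm (Set.mem_Ici.2 le_rfl) (Set.mem_Ici.2 hx) hx
  simp at this
  linarith

theorem mul_cosh_le_sinh {x : ℝ} (hx : 0 ≤ x) :
    (x - x ^ 3 / 3) * Real.cosh x ≤ Real.sinh x := by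
  have hm : MonotoneOn (fun y => Real.sinh y - (y - y ^ 3 / 3) * Real.cosh y) (Set.Ici 0) := by
    refine monotoneOn_of_hasDerivWithinAt_nonneg
      (f' := fun y => y ^ 2 * Real.cosh y - (y - y ^ 3 / 3) * Real.sinh y) (convex_Ici 0)
      (by fun_prop) (fun y _ => ?_) fun y hy => ?_
    · exact (((Real.hasDerivAt_sinh y).sub ((((hasDerivAt_id y).sub
        (((hasDerivAt_id y).pow 3).div_const 3))).mul (Real.hasDerivAt_cosh y))).congr_deriv
        (by simp; ring)).hasDerivWithinAt
    · simp only [interior_Ici, Set.mem_Ioi] at hy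
      have h1 := sinh_le_mul_cosh hy.le
      have h2 := Real.sinh_nonneg_iff.2 hy.le
      have h3 : 0 ≤ y ^ 3 / 3 * Real.sinh y := by positivity
      nlinarith
  have := hm (Set.mem_Ici.2 le_rfl) (Set.mem_Ici.2 hx) hx
  simp at this
  linarith

theorem sq_sub_pow_four_le_log_cosh (x : ℝ) : x ^ 2 / 2 - x ^ 4 / 12 ≤ Real.log (Real.cosh x) := by
  wlog hx : 0 ≤ x generalizing x
  · have := this (-x) (by linarith)
    rwa [Real.cosh_neg, even_two.neg_pow, (by decide : Even 4).neg_pow] at this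
  have hm : MonotoneOn (fun y => Real.log (Real.cosh y) - (y ^ 2 / 2 - y ^ 4 / 12))
      (Set.Ici 0) := by
    refine monotoneOn_of_hasDerivWithinAt_nonneg
      (f' := fun y => Real.sinh y / Real.cosh y - (y - y ^ 3 / 3)) (convex_Ici 0)
      ?_ (fun y _ => ?_) fun y hy => ?_
    · exact ((Real.continuous_cosh.log fun y => (Real.cosh_pos y).ne').sub
        (by fun_prop)).continuousOn
    · exact ((((Real.hasDerivAt_cosh y).log (Real.cosh_pos y).ne').sub
        ((((hasDerivAt_id y).pow 2).div_const 2).sub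
          (((hasDerivAt_id y).pow 4).div_const 12))).congr_deriv
        (by simp; ring)).hasDerivWithinAt
    · simp only [interior_Ici, Set.mem_Ioi] at hy
      rw [sub_nonneg, le_div_iff₀ (Real.cosh_pos y)]
      exact mul_cosh_le_sinh hy.le
  have := hm (Set.mem_Ici.2 le_rfl) (Set.mem_Ici.2 hx) hx
  simp at this
  linarith

theorem tanh_sq_le_sq (x : ℝ) : Real.tanh x ^ 2 ≤ x ^ 2 := by
  wlog hx : 0 ≤ x generalizing x
  · have := this (-x) (by linarith)
    rwa [Real.tanh_neg, neg_sq, neg_sq] at this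
  have h1 : Real.tanh x ≤ x := by
    rw [Real.tanh_eq_sinh_div_cosh, div_le_iff₀ (Real.cosh_pos x)]
    exact sinh_le_mul_cosh hx
  have h2 : 0 ≤ Real.tanh x := by
    rw [Real.tanh_eq_sinh_div_cosh]
    exact div_nonneg (Real.sinh_nonneg_iff.2 hx) (Real.cosh_pos x).le
  exact pow_le_pow_left₀ h2 h1 2

/-! ### Ising models -/

/-- The quadratic form `∑_{i < j} B i j * m i * m j`. At a spin configuration it is the energy of
the Ising model with couplings `B`; only the entries of `B` above the diagonal matter. -/
def energy {n : ℕ} (B : Fin n → Fin n → ℝ) (m : Fin n → ℝ) : ℝ :=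
  ∑ p : Pair n, B p.1.1 p.1.2 * m p.1.1 * m p.1.2

/-- The partition function of the Ising model with couplings `B` and no external field. -/
def partition {n : ℕ} (B : Fin n → Fin n → ℝ) : ℝ :=
  ∑ x : Cube n, Real.exp (energy B (spin x))

/-- The Gibbs measure of the Ising model with couplings `B` and no external field. -/
def isingGibbs {n : ℕ} (B : Fin n → Fin n → ℝ) (x : Cube n) : ℝ :=
  Real.exp (energy B (spin x)) / partition B

theorem partition_pos {n : ℕ} (B : Fin n → Fin n → ℝ) : 0 < partition B :=
  Finset.sum_pos (fun _ _ => Real.exp_pos _) Finset.univ_nonempty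

theorem isingGibbs_pos {n : ℕ} (B : Fin n → Fin n → ℝ) (x : Cube n) : 0 < isingGibbs B x :=
  div_pos (Real.exp_pos _) (partition_pos B)

theorem sum_isingGibbs {n : ℕ} (B : Fin n → Fin n → ℝ) : ∑ x, isingGibbs B x = 1 := by
  unfold isingGibbs
  rw [← Finset.sum_div]
  exact div_self (partition_pos B).ne'

theorem isingGibbs_mem_stdSimplex {n : ℕ} (B : Fin n → Fin n → ℝ) :
    isingGibbs B ∈ stdSimplex ℝ (Cube n) :=
  ⟨fun x => (isingGibbs_pos B x).le, sum_isingGibbs B⟩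

/-- Summation over pairs `i < j` is half of the summation over all `(i, j)`, for symmetric summands
that vanish on the diagonal. -/
theorem two_mul_sum_pair {n : ℕ} (φ : Fin n → Fin n → ℝ) (hs : ∀ i j, φ i j = φ j i)
    (h0 : ∀ i, φ i i = 0) : 2 * ∑ p : Pair n, φ p.1.1 p.1.2 = ∑ i, ∑ j, φ i j := by
  have h1 : ∑ p : Pair n, φ p.1.1 p.1.2 =
      ∑ i, ∑ j, if i < j then φ i j else 0 := by
    rw [← Fintype.sum_prod_type' (fun i j => if i < j then φ i j else 0), ← Finset.sum_filter]
    exact (Finset.sum_subtype _ (by simp) fun p : Fin n × Fin n => φ p.1 p.2).symm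
  have h2 : ∑ i, ∑ j, (if i < j then φ i j else 0) = ∑ i, ∑ j, if j < i then φ i j else 0 := by
    rw [Finset.sum_comm]
    simp only [hs]
  rw [two_mul]
  nth_rewrite 1 [h1]
  rw [h1, h2]
  nth_rewrite 1 [← h2]
  rw [← Finset.sum_add_distrib]
  refine Finset.sum_congr rfl fun i _ => ?_
  rw [← Finset.sum_add_distrib]
  refine Finset.sum_congr rfl fun j _ => ?_
  rcases lt_trichotomy i j with h | h | h
  · simp [h, h.not_gt]
  · simp [h, h0]
  · simp [h, h.not_gt]

theorem two_mul_energy {n : ℕ} {B : Fin n → Fin n → ℝ} (hs : ∀ i j, B i j = B j i)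
    (h0 : ∀ i, B i i = 0) (m : Fin n → ℝ) : 2 * energy B m = ∑ i, ∑ j, B i j * m i * m j :=
  two_mul_sum_pair (fun i j => B i j * m i * m j) (fun i j => by rw [hs i j]; ring)
    fun i => by simp [h0]

theorem energy_smul {n : ℕ} (B : Fin n → Fin n → ℝ) (c : ℝ) (m : Fin n → ℝ) :
    energy B (fun i => c * m i) = c ^ 2 * energy B m := by
  unfold energy
  rw [Finset.mul_sum]
  exact Finset.sum_congr rfl fun p _ => by ring

/-! ### Conditional covariances of an Ising model -/

theorem self_mem_agree {n : ℕ} (T : Finset (Fin n)) (x : Cube n) : x ∈ agree T x := by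
  simp [agree]

theorem mem_agree_comm {n : ℕ} {T : Finset (Fin n)} {x y : Cube n} :
    y ∈ agree T x ↔ x ∈ agree T y := by
  simp [agree, eq_comm]

theorem agree_eq_of_mem {n : ℕ} {T : Finset (Fin n)} {x y : Cube n} (h : y ∈ agree T x) :
    agree T y = agree T x := by
  have h' : ∀ k ∈ T, y k = x k := by simpa [agree] using h
  ext z
  simp only [agree, Finset.mem_filter, Finset.mem_univ, true_and]
  exact forall₂_congr fun k hk => by rw [h' k hk]

/-- The number of configurations that agree with `x` on `T`. -/
theorem card_agree {n : ℕ} (T : Finset (Fin n)) (x : Cube n) :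
    ((agree T x).card : ℝ) * 2 ^ T.card = 2 ^ n := by
  have h : agree T x = Fintype.piFinset fun k => if k ∈ T then {x k} else Finset.univ := by
    ext y
    simp only [agree, Finset.mem_filter, Finset.mem_univ, true_and, Fintype.mem_piFinset]
    refine forall_congr' fun k => ?_
    by_cases hk : k ∈ T <;> simp [hk, Int.units_eq_one_or]
  have h2 : ∀ k, (if k ∈ T then {x k} else Finset.univ : Finset ℤˣ).card
      = if k ∈ T then 1 else 2 := by
    intro k
    by_cases hk : k ∈ T <;> simp [hk]
  rw [h, Fintype.card_piFinset]
  simp only [h2]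
  rw [Finset.prod_ite]
  simp only [Finset.prod_const, one_pow, one_mul]
  push_cast
  rw [← pow_add]
  congr 1
  have h3 := Finset.card_filter_add_card_filter_not (s := (Finset.univ : Finset (Fin n)))
    (fun k => k ∈ T)
  simp only [Finset.card_univ, Fintype.card_fin] at h3
  have h4 : (Finset.univ.filter fun k : Fin n => k ∈ T).card = T.card := by simp
  omega

/-- A probability vector on the cube whose mean is `m` has relative entropy at least `|m|² / 2`
with respect to the uniform distribution. -/
theorem sum_mul_log_ge {n : ℕ} {ν : Cube n → ℝ} (hν : ν ∈ stdSimplex ℝ (Cube n)) :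
    (∑ i, (∑ y, ν y * spin y i) ^ 2) / 2 - n * Real.log 2 ≤ ∑ y, ν y * Real.log (ν y) := by
  set m : Fin n → ℝ := fun i => ∑ y, ν y * spin y i with hm
  -- test the variational principle against the external field `m`
  have h1 := sum_mul_sub_log_le_log_sum_exp hν fun y => ∑ i, m i * spin y i
  have h2 : Real.log (∑ y : Cube n, Real.exp (∑ i, m i * spin y i))
      ≤ n * Real.log 2 + (∑ i, m i ^ 2) / 2 := by
    rw [sum_exp_sum_mul_spin, Real.log_prod fun i _ => by have := Real.cosh_pos (m i); positivity]
    have h3 : ∀ i, Real.log (2 * Real.cosh (m i)) ≤ Real.log 2 + m i ^ 2 / 2 := by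
      intro i
      rw [Real.log_mul two_ne_zero (Real.cosh_pos _).ne']
      gcongr
      exact (Real.log_le_log (Real.cosh_pos _) (Real.cosh_le_exp_half_sq _)).trans_eq
        (Real.log_exp _)
    refine (Finset.sum_le_sum fun i _ => h3 i).trans_eq ?_
    simp [Finset.sum_add_distrib, Finset.sum_div]
  have h4 : ∑ y, ν y * (∑ i, m i * spin y i) = ∑ i, m i ^ 2 := by
    simp only [Finset.mul_sum]
    rw [Finset.sum_comm]
    refine Finset.sum_congr rfl fun i _ => ?_
    rw [sq]
    nth_rewrite 3 [hm]
    rw [Finset.mul_sum]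
    exact Finset.sum_congr rfl fun y _ => by ring
  simp only [mul_sub, Finset.sum_sub_distrib, h4] at h1
  linarith

/-- The heart of the matter. Given `X_T = x_T`, the Gibbs measure exceeds the product measure with
the same means in average energy by the coupling-weighted covariances. Since a product measure
cannot gain more energy than it loses entropy, the excess is at least the free energy gain of the
model, up to the price `log ℙ(X_T = x_T)` of the conditioning. -/
theorem sum_mul_condCov_ge {n : ℕ} {B : Fin n → Fin n → ℝ}
    (hB : ∀ m, energy B m ≤ (∑ i, m i ^ 2) / 2) (T : Finset (Fin n)) (x : Cube n) :
    Real.log (partition B) - n * Real.log 2 + Real.log (∑ y ∈ agree T x, isingGibbs B y)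
      ≤ ∑ p : Pair n, B p.1.1 p.1.2 * condCov (isingGibbs B) T x p.1.1 p.1.2 := by
  set M := ∑ y ∈ agree T x, isingGibbs B y with hM
  have hMpos : 0 < M :=
    Finset.sum_pos (fun y _ => isingGibbs_pos B y) ⟨x, self_mem_agree T x⟩
  set ν : Cube n → ℝ := fun y => if y ∈ agree T x then isingGibbs B y / M else 0 with hν
  have hcond : ∀ f, condExp (isingGibbs B) T x f = ∑ y, ν y * f y := by
    intro f
    simp only [condExp, hν, ite_mul, zero_mul]
    rw [← Finset.sum_filter, Finset.filter_mem_eq_inter, Finset.univ_inter, Finset.sum_div]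
    exact Finset.sum_congr rfl fun y _ => by rw [← hM]; ring
  have hsum : ∑ y, ν y = 1 := by
    have := hcond fun _ => 1
    simp only [mul_one] at this
    rw [← this, condExp]
    simp only [mul_one]
    exact div_self hMpos.ne'
  have hmem : ν ∈ stdSimplex ℝ (Cube n) := by
    refine ⟨fun y => ?_, hsum⟩
    simp only [hν]
    split_ifs
    · exact (div_pos (isingGibbs_pos B y) hMpos).le
    · exact le_rfl
  have hent := sum_mul_log_ge hmem
  set m : Fin n → ℝ := fun i => ∑ y, ν y * spin y i with hm
  have hE : ∑ y, ν y * Real.log (ν y)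
      = ∑ y, ν y * energy B (spin y) - Real.log (partition B) - Real.log M := by
    have h1 : ∀ y, ν y * Real.log (ν y)
        = ν y * energy B (spin y) - ν y * Real.log (partition B) - ν y * Real.log M := by
      intro y
      by_cases hy : y ∈ agree T x
      · have : Real.log (ν y) = energy B (spin y) - Real.log (partition B) - Real.log M := by
          simp only [hν, if_pos hy, isingGibbs]
          rw [Real.log_div (div_pos (Real.exp_pos _) (partition_pos B)).ne' hMpos.ne',
            Real.log_div (Real.exp_pos _).ne' (partition_pos B).ne', Real.log_exp]
        rw [this]; ring
      · simp [hν, hy]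
    simp only [h1, Finset.sum_sub_distrib, ← Finset.sum_mul, hsum, one_mul]
  have hcov : ∑ p : Pair n, B p.1.1 p.1.2 * condCov (isingGibbs B) T x p.1.1 p.1.2
      = ∑ y, ν y * energy B (spin y) - energy B m := by
    simp only [condCov, hcond, energy, mul_sub, Finset.sum_sub_distrib]
    congr 1
    · simp only [Finset.mul_sum]
      rw [Finset.sum_comm]
      exact Finset.sum_congr rfl fun y _ => Finset.sum_congr rfl fun p _ => by ring
    · refine Finset.sum_congr rfl fun p _ => ?_
      simp only [hm]
      ring
  rw [hcov]
  have := hB m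
  change (∑ i, m i ^ 2) / 2 - n * Real.log 2 ≤ _ at hent
  rw [hE] at hent
  linarith

/-- The entropy of `X_T` is at most `|T| log 2`. -/
theorem sum_mul_log_sum_agree_ge {n : ℕ} {μ : Cube n → ℝ} (hpos : ∀ x, 0 < μ x)
    (hsum : ∑ x, μ x = 1) (T : Finset (Fin n)) :
    -(T.card * Real.log 2) ≤ ∑ x, μ x * Real.log (∑ y ∈ agree T x, μ y) := by
  set M : Cube n → ℝ := fun x => ∑ y ∈ agree T x, μ y with hM
  have hMpos : ∀ x, 0 < M x := fun x =>
    Finset.sum_pos (fun y _ => hpos y) ⟨x, self_mem_agree T x⟩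
  have hMcongr : ∀ {x y}, y ∈ agree T x → M y = M x := fun h => by
    simp only [hM, agree_eq_of_mem h]
  -- the number of patterns on `T`, computed by double counting over the fibres of `x ↦ x_T`
  have hcount : ∑ x, μ x / M x = 2 ^ T.card := by
    have h1 : ∑ x, μ x / M x * (agree T x).card = 2 ^ n := by
      calc ∑ x, μ x / M x * (agree T x).card
          = ∑ x, ∑ y, if y ∈ agree T x then μ x / M x else 0 := by
            refine Finset.sum_congr rfl fun x _ => ?_
            rw [← Finset.sum_filter, Finset.filter_mem_eq_inter, Finset.univ_inter,
              Finset.sum_const, nsmul_eq_mul, mul_comm]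
        _ = ∑ y, ∑ x, if x ∈ agree T y then μ x / M y else 0 := by
            rw [Finset.sum_comm]
            refine Finset.sum_congr rfl fun y _ => Finset.sum_congr rfl fun x _ => ?_
            by_cases h : y ∈ agree T x
            · rw [if_pos h, if_pos (mem_agree_comm.1 h), hMcongr h]
            · rw [if_neg h, if_neg fun h' => h (mem_agree_comm.1 h')]
        _ = ∑ y : Cube n, (1 : ℝ) := by
            refine Finset.sum_congr rfl fun y _ => ?_
            rw [← Finset.sum_filter, Finset.filter_mem_eq_inter, Finset.univ_inter,
              ← Finset.sum_div]
            exact div_self (hMpos y).ne'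
        _ = 2 ^ n := by simp
    have h2 : ∀ x, μ x / M x * (agree T x).card = μ x / M x * (2 ^ n / 2 ^ T.card) := by
      intro x
      rw [← card_agree T x]
      field_simp
    rw [Finset.sum_congr rfl fun x _ => h2 x, ← Finset.sum_mul] at h1
    field_simp at h1
    exact h1
  have key : ∀ x, μ x * (-Real.log (M x) - T.card * Real.log 2)
      ≤ μ x / M x / 2 ^ T.card - μ x := by
    intro x
    have h := Real.log_le_sub_one_of_pos (x := 1 / (M x * 2 ^ T.card))
      (by have := hMpos x; positivity)
    rw [one_div, Real.log_inv, Real.log_mul (hMpos x).ne' (by positivity), Real.log_pow] at h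
    calc _ ≤ μ x * ((M x * 2 ^ T.card)⁻¹ - 1) :=
          mul_le_mul_of_nonneg_left (by linarith) (hpos x).le
      _ = _ := by rw [mul_inv]; ring
  have h := Finset.sum_le_sum fun x (_ : x ∈ Finset.univ) => key x
  simp only [mul_sub, Finset.sum_sub_distrib, ← Finset.sum_mul, ← Finset.sum_div, hcount, hsum,
    mul_neg, Finset.sum_neg_distrib] at h
  rw [div_self (by positivity)] at h
  linarith

/-- In an Ising model whose couplings are bounded by `b` and do not exceed the threshold of the
mean-field transition, the average conditional covariance is bounded below by the free energy gain,
whatever the conditioning set is. -/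
theorem avgCondCov_isingGibbs_ge {n : ℕ} {B : Fin n → Fin n → ℝ}
    (hB : ∀ m, energy B m ≤ (∑ i, m i ^ 2) / 2) {b : ℝ} (hb : ∀ i j, |B i j| ≤ b)
    (hn : 2 ≤ n) (T : Finset (Fin n)) :
    Real.log (partition B) - n * Real.log 2 - T.card * Real.log 2
      ≤ n.choose 2 * b * avgCondCov (isingGibbs B) T := by
  have hc : (0 : ℝ) < n.choose 2 := by exact_mod_cast Nat.choose_pos hn
  have h1 : ∀ x, ∑ p : Pair n, B p.1.1 p.1.2 * condCov (isingGibbs B) T x p.1.1 p.1.2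
      ≤ ∑ p : Pair n, b * |condCov (isingGibbs B) T x p.1.1 p.1.2| := fun x =>
    Finset.sum_le_sum fun p _ => (le_abs_self _).trans <| by
      rw [abs_mul]
      exact mul_le_mul_of_nonneg_right (hb _ _) (abs_nonneg _)
  have h2 := Finset.sum_le_sum fun x (_ : x ∈ Finset.univ) =>
    mul_le_mul_of_nonneg_left ((sum_mul_condCov_ge hB T x).trans (h1 x)) (isingGibbs_pos B x).le
  simp only [mul_add, Finset.sum_add_distrib, ← Finset.sum_mul, sum_isingGibbs, one_mul] at h2
  have h3 := sum_mul_log_sum_agree_ge (isingGibbs_pos B) (sum_isingGibbs B) T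
  have h4 : n.choose 2 * b * avgCondCov (isingGibbs B) T
      = ∑ x, isingGibbs B x * ∑ p : Pair n, b * |condCov (isingGibbs B) T x p.1.1 p.1.2| := by
    unfold avgCondCov
    rw [mul_comm (n.choose 2 : ℝ), mul_assoc, mul_div_cancel₀ _ hc.ne', Finset.mul_sum]
    simp only [Finset.mul_sum]
    rw [Finset.sum_comm]
    exact Finset.sum_congr rfl fun x _ => Finset.sum_congr rfl fun p _ => by ring
  rw [h4]
  linarith

/-! ### A lower bound for the free energy -/

theorem sum_exp_mul_spin_div_cosh {n : ℕ} (f : Fin n → ℝ) :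
    ∑ v : Cube n, ∏ k, Real.exp (f k * spin v k) / (2 * Real.cosh (f k)) = 1 := by
  unfold spin
  rw [sum_prod_units fun k s => Real.exp (f k * ((s : ℤ) : ℝ)) / (2 * Real.cosh (f k))]
  refine Finset.prod_eq_one fun k _ => ?_
  rw [← add_div, div_eq_one_iff_eq (by have := Real.cosh_pos (f k); positivity), Real.cosh_eq]
  simp
  ring

/-- Under the product measure with external field `f`, distinct spins have correlation
`tanh (f i) * tanh (f j)`. -/
theorem sum_exp_mul_spin_div_cosh_mul_spin_mul_spin {n : ℕ} (f : Fin n → ℝ) {i j : Fin n}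
    (hij : i ≠ j) :
    ∑ v : Cube n, (∏ k, Real.exp (f k * spin v k) / (2 * Real.cosh (f k)))
      * (spin v i * spin v j) = Real.tanh (f i) * Real.tanh (f j) := by
  have h1 : ∀ g : Fin n → ℝ, g i * g j = ∏ k, if k = i ∨ k = j then g k else 1 := by
    intro g
    rw [← Finset.prod_filter, show (Finset.univ.filter fun k => k = i ∨ k = j) = {i, j} by
      ext; simp, Finset.prod_pair hij]
  rw [h1 fun k => Real.tanh (f k)]
  have h2 : ∀ v : Cube n, (∏ k, Real.exp (f k * spin v k) / (2 * Real.cosh (f k)))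
      * (spin v i * spin v j) = ∏ k, Real.exp (f k * spin v k) / (2 * Real.cosh (f k))
        * (if k = i ∨ k = j then spin v k else 1) := by
    intro v
    rw [h1 (spin v), ← Finset.prod_mul_distrib]
  simp only [h2]
  unfold spin
  rw [sum_prod_units fun k s => Real.exp (f k * ((s : ℤ) : ℝ)) / (2 * Real.cosh (f k))
        * (if k = i ∨ k = j then ((s : ℤ) : ℝ) else 1)]
  refine Finset.prod_congr rfl fun k _ => ?_
  have hc := (Real.cosh_pos (f k)).ne'
  split_ifs
  · rw [Real.tanh_eq_sinh_div_cosh, Real.sinh_eq]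
    simp
    field_simp
    ring
  · rw [mul_one, mul_one, ← add_div, div_eq_one_iff_eq (by positivity), Real.cosh_eq]
    simp
    ring

/-- The naive mean-field lower bound for an Ising model with external field `f`, evaluated at the
means of the product measure with the same field. -/
theorem log_sum_exp_field_ge {n : ℕ} (C : Fin n → Fin n → ℝ) (f : Fin n → ℝ) :
    n * Real.log 2 + ∑ j, Real.log (Real.cosh (f j)) + energy C (fun j => Real.tanh (f j))
      ≤ Real.log (∑ v : Cube n, Real.exp (∑ j, f j * spin v j + energy C (spin v))) := by
  set q : Cube n → ℝ := fun v => ∏ k, Real.exp (f k * spin v k) / (2 * Real.cosh (f k)) with hq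
  have hqpos : ∀ v, 0 < q v := fun v =>
    Finset.prod_pos fun k _ => by have := Real.cosh_pos (f k); positivity
  have hsum : ∑ v, q v = 1 := sum_exp_mul_spin_div_cosh f
  refine le_trans (le_of_eq ?_) (sum_mul_sub_log_le_log_sum_exp ⟨fun v => (hqpos v).le, hsum⟩
    fun v => ∑ j, f j * spin v j + energy C (spin v))
  have hlog : ∀ v, Real.log (q v) = ∑ j, f j * spin v j
      - (n * Real.log 2 + ∑ j, Real.log (Real.cosh (f j))) := by
    intro v
    simp only [hq]
    rw [Real.log_prod fun k _ => by have := Real.cosh_pos (f k); positivity]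
    have : ∀ k, Real.log (Real.exp (f k * spin v k) / (2 * Real.cosh (f k)))
        = f k * spin v k - (Real.log 2 + Real.log (Real.cosh (f k))) := by
      intro k
      have := Real.cosh_pos (f k)
      rw [Real.log_div (Real.exp_pos _).ne' (by positivity), Real.log_exp,
        Real.log_mul two_ne_zero this.ne']
    simp [this, Finset.sum_sub_distrib, Finset.sum_add_distrib]
  have hen : ∑ v, q v * energy C (spin v) = energy C fun j => Real.tanh (f j) := by
    simp only [energy, Finset.mul_sum]
    rw [Finset.sum_comm]
    refine Finset.sum_congr rfl fun p _ => ?_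
    rw [mul_assoc, ← sum_exp_mul_spin_div_cosh_mul_spin_mul_spin f p.2.ne, Finset.mul_sum]
    exact Finset.sum_congr rfl fun v _ => by simp only [hq]; ring
  have h : ∀ v, q v * (∑ j, f j * spin v j + energy C (spin v) - Real.log (q v))
      = q v * energy C (spin v) + q v * (n * Real.log 2 + ∑ j, Real.log (Real.cosh (f j))) := by
    intro v
    rw [hlog]
    ring
  simp only [h, Finset.sum_add_distrib, ← Finset.sum_mul, hsum, hen]
  ring

/-- Resampling the coordinates outside `S` of a uniform configuration. -/
theorem sum_sum_piecewise {n : ℕ} (S : Finset (Fin n)) (F : Cube n → ℝ) :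
    ∑ u : Cube n, ∑ v : Cube n, F (S.piecewise u v) = 2 ^ n * ∑ x, F x := by
  have hinv : Function.Involutive fun w : Cube n × Cube n =>
      (S.piecewise w.1 w.2, S.piecewise w.2 w.1) := by
    rintro ⟨u, v⟩
    ext i <;> by_cases h : i ∈ S <;> simp [h]
  rw [← Fintype.sum_prod_type' fun u v => F (S.piecewise u v)]
  have := Equiv.sum_comp (hinv.toPerm _) fun w : Cube n × Cube n => F w.1
  simp only [Function.Involutive.coe_toPerm] at this
  rw [this, Fintype.sum_prod_type]
  simp [Finset.mul_sum]

/-- Jensen's inequality for the exponential and the uniform distribution on the cube. -/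
theorem mul_log_two_add_average_le_log_sum_exp {n : ℕ} (G : Cube n → ℝ) :
    n * Real.log 2 + (∑ u, G u) / 2 ^ n ≤ Real.log (∑ u, Real.exp (G u)) := by
  have h := sum_mul_sub_log_le_log_sum_exp (ν := fun _ : Cube n => (1 : ℝ) / 2 ^ n)
    ⟨fun _ => by positivity, by simp⟩ G
  refine le_trans (le_of_eq ?_) h
  rw [← Finset.mul_sum, Finset.sum_sub_distrib, Finset.sum_const, Finset.card_univ, nsmul_eq_mul,
    card_cube, one_div, Real.log_inv, Real.log_pow]
  field_simp
  ring

/-- The field that the spins in `S` exert on the site `j`; it is set to `0` for `j ∈ S`. -/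
def blockField {n : ℕ} (B : Fin n → Fin n → ℝ) (S : Finset (Fin n)) (u : Cube n) (j : Fin n) : ℝ :=
  if j ∈ S then 0 else ∑ i ∈ S, B i j * spin u i

/-- The energy splits into the energies inside the two blocks and the interaction. -/
theorem energy_piecewise {n : ℕ} {B : Fin n → Fin n → ℝ} (hs : ∀ i j, B i j = B j i)
    (h0 : ∀ i, B i i = 0) (S : Finset (Fin n)) (u v : Cube n) :
    energy B (spin (S.piecewise u v))
      = energy B (fun i => if i ∈ S then spin u i else 0)
        + (∑ j, blockField B S u j * spin v j
          + energy (fun i j => if i ∈ S ∨ j ∈ S then 0 else B i j) (spin v)) := by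
  set a : Fin n → ℝ := fun i => if i ∈ S then spin u i else 0 with ha
  set b : Fin n → ℝ := fun i => if i ∈ S then 0 else spin v i with hb
  have hw : ∀ i, spin (S.piecewise u v) i = a i + b i := by
    intro i
    by_cases h : i ∈ S <;> simp [ha, hb, h, spin]
  have h1 : energy (fun i j => if i ∈ S ∨ j ∈ S then 0 else B i j) (spin v) = energy B b := by
    refine Finset.sum_congr rfl fun p _ => ?_
    by_cases h : p.1.1 ∈ S <;> by_cases h' : p.1.2 ∈ S <;> simp [hb, h, h']
  have h2 : ∑ j, blockField B S u j * spin v j = ∑ i, ∑ j, B i j * a i * b j := by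
    rw [Finset.sum_comm]
    refine Finset.sum_congr rfl fun j _ => ?_
    by_cases h : j ∈ S
    · simp [blockField, hb, h]
    · simp only [blockField, hb, ha, h, if_false, ← Finset.sum_mul, mul_ite, mul_zero]
      rw [← Finset.sum_filter, Finset.filter_mem_eq_inter, Finset.univ_inter]
  have h3 : ∑ i, ∑ j, B i j * b i * a j = ∑ i, ∑ j, B i j * a i * b j := by
    rw [Finset.sum_comm]
    exact Finset.sum_congr rfl fun i _ => Finset.sum_congr rfl fun j _ => by rw [hs]; ring
  have h4 := two_mul_energy hs h0 (spin (S.piecewise u v))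
  have h5 : ∑ i, ∑ j, B i j * spin (S.piecewise u v) i * spin (S.piecewise u v) j
      = ∑ i, ∑ j, B i j * a i * a j + ∑ i, ∑ j, B i j * b i * b j
        + (∑ i, ∑ j, B i j * a i * b j + ∑ i, ∑ j, B i j * b i * a j) := by
    simp only [hw, ← Finset.sum_add_distrib]
    exact Finset.sum_congr rfl fun i _ => Finset.sum_congr rfl fun j _ => by ring
  rw [h1, h2]
  rw [h5, ← two_mul_energy hs h0, ← two_mul_energy hs h0, h3] at h4
  linarith

/-- Lower bound for the free energy of an Ising model. The spins in a block `S` are taken uniform,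
and the remaining ones independent in the field exerted by the block. The hypothesis on the
energy makes the interactions outside `S` harmless. -/
theorem log_partition_ge {n : ℕ} {B : Fin n → Fin n → ℝ} (hs : ∀ i j, B i j = B j i)
    (h0 : ∀ i, B i i = 0) (S : Finset (Fin n)) {ε : ℝ} (hε0 : 0 ≤ ε)
    (hε : ∀ m : Fin n → ℝ, (∀ i ∈ S, m i = 0) → -(ε * ∑ i, m i ^ 2) ≤ energy B m) :
    n * Real.log 2 + ∑ j ∈ Sᶜ, ((1 / 2 - ε) * ∑ i ∈ S, B i j ^ 2 - (∑ i ∈ S, B i j ^ 2) ^ 2 / 4)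
      ≤ Real.log (partition B) := by
  -- `G u` bounds the free energy of the spins outside `S` when those in `S` are frozen to `u`
  set e : Cube n → ℝ := fun u => energy B (fun i => if i ∈ S then spin u i else 0) with he
  set f := blockField B S with hf
  set G : Cube n → ℝ := fun u =>
    e u + (n * Real.log 2 + ∑ j ∈ Sᶜ, ((1 / 2 - ε) * f u j ^ 2 - f u j ^ 4 / 12)) with hG
  have hinner : ∀ u, Real.exp (G u) ≤
      ∑ v : Cube n, Real.exp (energy B (spin (S.piecewise u v))) := by
    intro u
    have hpos : 0 < ∑ v : Cube n, Real.exp (∑ j, f u j * spin v j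
        + energy (fun i j => if i ∈ S ∨ j ∈ S then 0 else B i j) (spin v)) :=
      Finset.sum_pos (fun _ _ => Real.exp_pos _) Finset.univ_nonempty
    have h1 := log_sum_exp_field_ge (fun i j => if i ∈ S ∨ j ∈ S then 0 else B i j) (f u)
    have hz : ∀ i ∈ S, f u i = 0 := fun i hi => by simp [hf, blockField, hi]
    have h2 : energy (fun i j => if i ∈ S ∨ j ∈ S then 0 else B i j) (fun j => Real.tanh (f u j))
        = energy B (fun j => Real.tanh (f u j)) := by
      refine Finset.sum_congr rfl fun p _ => ?_
      by_cases h : p.1.1 ∈ S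
      · simp [h, hz _ h]
      · by_cases h' : p.1.2 ∈ S
        · simp [h', hz _ h']
        · simp [h, h']
    have h3 := hε (fun j => Real.tanh (f u j)) fun i hi => by simp [hz i hi]
    have h4 : ∑ j ∈ Sᶜ, ((1 / 2 - ε) * f u j ^ 2 - f u j ^ 4 / 12)
        ≤ ∑ j, Real.log (Real.cosh (f u j)) - ε * ∑ j, Real.tanh (f u j) ^ 2 := by
      rw [Finset.mul_sum, ← Finset.sum_sub_distrib]
      have h5 : ∑ j ∈ Sᶜ, ((1 / 2 - ε) * f u j ^ 2 - f u j ^ 4 / 12)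
          = ∑ j, ((1 / 2 - ε) * f u j ^ 2 - f u j ^ 4 / 12) := by
        refine Finset.sum_subset (Finset.subset_univ _) fun j _ hj => ?_
        rw [hz j (by simpa using hj)]
        simp
      rw [h5]
      refine Finset.sum_le_sum fun j _ => ?_
      have h6 := sq_sub_pow_four_le_log_cosh (f u j)
      have h7 := mul_le_mul_of_nonneg_left (tanh_sq_le_sq (f u j)) hε0
      linarith
    calc Real.exp (G u)
        ≤ Real.exp (e u) * ∑ v : Cube n, Real.exp (∑ j, f u j * spin v j
          + energy (fun i j => if i ∈ S ∨ j ∈ S then 0 else B i j) (spin v)) := by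
          rw [hG, Real.exp_add]
          refine mul_le_mul_of_nonneg_left ?_ (Real.exp_pos _).le
          rw [← Real.le_log_iff_exp_le hpos]
          rw [h2] at h1
          linarith
      _ = _ := by
          rw [Finset.mul_sum]
          refine Finset.sum_congr rfl fun v _ => ?_
          rw [← Real.exp_add, energy_piecewise hs h0]
  have hpos2 : 0 < ∑ u, Real.exp (G u) :=
    Finset.sum_pos (fun _ _ => Real.exp_pos _) Finset.univ_nonempty
  have h1 : Real.log (∑ u, Real.exp (G u)) ≤ n * Real.log 2 + Real.log (partition B) := by
    have h2 := Finset.sum_le_sum fun u (_ : u ∈ Finset.univ) => hinner u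
    rw [sum_sum_piecewise S fun x => Real.exp (energy B (spin x))] at h2
    have h3 : _ ≤ Real.log (2 ^ n * partition B) := Real.log_le_log hpos2 h2
    rwa [Real.log_mul (by positivity) (partition_pos B).ne', Real.log_pow] at h3
  have h2 := mul_log_two_add_average_le_log_sum_exp G
  have hesum : ∑ u, e u = 0 := by
    simp only [he, energy]
    rw [Finset.sum_comm]
    refine Finset.sum_eq_zero fun p _ => ?_
    by_cases h : p.1.1 ∈ S
    · by_cases h' : p.1.2 ∈ S
      · simp only [h, h', if_true, mul_assoc, ← Finset.mul_sum]
        rw [sum_spin_mul_spin p.2.ne, mul_zero]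
      · simp [h']
    · simp [h]
  have hmom : ∀ j ∈ Sᶜ, 2 ^ n * ((1 / 2 - ε) * ∑ i ∈ S, B i j ^ 2
      - (∑ i ∈ S, B i j ^ 2) ^ 2 / 4)
      ≤ ∑ u : Cube n, ((1 / 2 - ε) * f u j ^ 2 - f u j ^ 4 / 12) := by
    intro j hj
    have hj' : j ∉ S := by simpa using hj
    simp only [hf, blockField, hj', if_false, Finset.sum_sub_distrib, ← Finset.mul_sum,
      ← Finset.sum_div]
    rw [sum_linear_sq fun i => B i j]
    have := sum_linear_pow_four_le (fun i => B i j) S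
    linarith
  have hGsum : 2 ^ n * (n * Real.log 2 + ∑ j ∈ Sᶜ, ((1 / 2 - ε) * ∑ i ∈ S, B i j ^ 2
      - (∑ i ∈ S, B i j ^ 2) ^ 2 / 4)) ≤ ∑ u, G u := by
    simp only [hG, Finset.sum_add_distrib, hesum, Finset.sum_const, Finset.card_univ,
      nsmul_eq_mul, card_cube]
    rw [Finset.sum_comm, mul_add, Finset.mul_sum, zero_add]
    gcongr with j hj
    exact hmom j hj
  have h3 : n * Real.log 2 + ∑ j ∈ Sᶜ, ((1 / 2 - ε) * ∑ i ∈ S, B i j ^ 2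
      - (∑ i ∈ S, B i j ^ 2) ^ 2 / 4) ≤ (∑ u, G u) / 2 ^ n := by
    rw [le_div_iff₀ (by positivity)]
    linarith
  linarith

/-! ### Bipartite Ising models with Hadamard couplings -/

/-- Sylvester's Hadamard matrices. -/
theorem exists_isHadamard_two_pow (k : ℕ) :
    ∃ W : Matrix (Fin (2 ^ k)) (Fin (2 ^ k)) ℝ, W.IsHadamard := by
  induction k with
  | zero =>
    have : Subsingleton (Fin (2 ^ 0)) := inferInstanceAs (Subsingleton (Fin 1))
    refine ⟨1, fun i j => ?_, ?_, ?_⟩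
    · rw [Subsingleton.elim i j, Matrix.one_apply_eq]
      exact one_mem _
    · simp
    · simp
  | succ k ih =>
    obtain ⟨W, hW⟩ := ih
    have h2 : (!![1, 1; 1, -1] : Matrix (Fin 2) (Fin 2) ℝ).IsHadamard := by
      refine ⟨fun i j => ?_, ?_, ?_⟩
      · rw [Unitary.mem_iff_eq_one_or_eq_neg_one]
        fin_cases i <;> fin_cases j <;> simp
      · ext i j
        fin_cases i <;> fin_cases j <;> norm_num [Matrix.mul_apply, Fin.sum_univ_two]
      · ext i j
        fin_cases i <;> fin_cases j <;> norm_num [Matrix.mul_apply, Fin.sum_univ_two]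
    have e : Fin (2 ^ k) × Fin 2 ≃ Fin (2 ^ (k + 1)) :=
      finProdFinEquiv.trans (finCongr (pow_succ 2 k).symm)
    exact ⟨_, (hW.kronecker h2).reindex e e⟩

/-- A real Hadamard matrix scales Euclidean norms by the square root of its order. -/
theorem sum_hadamard_mulVec_sq {N : ℕ} {W : Matrix (Fin N) (Fin N) ℝ} (hW : W.IsHadamard)
    (v : Fin N → ℝ) : ∑ a, (∑ b, W a b * v b) ^ 2 = N * ∑ b, v b ^ 2 := by
  have h1 : ∀ b c, ∑ a, W a b * W a c = if b = c then (N : ℝ) else 0 := by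
    intro b c
    have := congrFun (congrFun hW.conjTranspose_mul b) c
    simpa [Matrix.mul_apply, Matrix.one_apply] using this
  calc ∑ a, (∑ b, W a b * v b) ^ 2
      = ∑ a, ∑ b, ∑ c, v b * v c * (W a b * W a c) := by
        refine Finset.sum_congr rfl fun a _ => ?_
        rw [sq, Finset.sum_mul_sum]
        exact Finset.sum_congr rfl fun b _ => Finset.sum_congr rfl fun c _ => by ring
    _ = ∑ b, ∑ c, v b * v c * ∑ a, W a b * W a c := by
        rw [Finset.sum_comm]
        refine Finset.sum_congr rfl fun b _ => ?_
        rw [Finset.sum_comm]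
        exact Finset.sum_congr rfl fun c _ => by rw [Finset.mul_sum]
    _ = N * ∑ b, v b ^ 2 := by
        simp only [h1, mul_ite, mul_zero, Finset.sum_ite_eq, Finset.mem_univ, if_true,
          Finset.mul_sum]
        exact Finset.sum_congr rfl fun b _ => by ring

theorem hadamard_sq {N : ℕ} {W : Matrix (Fin N) (Fin N) ℝ} (hW : W.IsHadamard) (a b : Fin N) :
    W a b ^ 2 = 1 := by
  have := (Unitary.mem_iff.1 (hW.apply_mem a b)).1
  simpa [sq] using this

/-- The couplings `W a b / √N` between site `a` of the first half and site `b` of the second half,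
with no couplings inside the halves. -/
def bipartite {N : ℕ} (W : Matrix (Fin N) (Fin N) ℝ) (i j : Fin (N + N)) : ℝ :=
  Matrix.fromBlocks 0 W W.transpose 0 (finSumFinEquiv.symm i) (finSumFinEquiv.symm j) / Real.sqrt N

section Bipartite

variable {N : ℕ} (W : Matrix (Fin N) (Fin N) ℝ)

theorem bipartite_left_left (a b : Fin N) :
    bipartite W (Fin.castAdd N a) (Fin.castAdd N b) = 0 := by
  simp [bipartite]

theorem bipartite_left_right (a b : Fin N) :
    bipartite W (Fin.castAdd N a) (Fin.natAdd N b) = W a b / Real.sqrt N := by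
  simp [bipartite, -Fin.natAdd_eq_addNat]

theorem bipartite_right_left (a b : Fin N) :
    bipartite W (Fin.natAdd N a) (Fin.castAdd N b) = W b a / Real.sqrt N := by
  simp [bipartite, -Fin.natAdd_eq_addNat]

theorem bipartite_right_right (a b : Fin N) :
    bipartite W (Fin.natAdd N a) (Fin.natAdd N b) = 0 := by
  simp [bipartite, -Fin.natAdd_eq_addNat]

theorem bipartite_symm (i j : Fin (N + N)) : bipartite W i j = bipartite W j i := by
  refine Fin.addCases (fun a => ?_) (fun a => ?_) i <;>
    refine Fin.addCases (fun b => ?_) (fun b => ?_) j <;>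
    simp only [bipartite_left_left, bipartite_left_right, bipartite_right_left,
      bipartite_right_right]

theorem bipartite_diag (i : Fin (N + N)) : bipartite W i i = 0 := by
  refine Fin.addCases (fun a => ?_) (fun a => ?_) i
  · exact bipartite_left_left W a a
  · exact bipartite_right_right W a a

theorem energy_bipartite (m : Fin (N + N) → ℝ) :
    energy (bipartite W) m =
      ∑ a, m (Fin.castAdd N a) * ((∑ b, W a b * m (Fin.natAdd N b)) / Real.sqrt N) := by
  have h := two_mul_energy (bipartite_symm W) (bipartite_diag W) m
  simp only [Fin.sum_univ_add, bipartite_left_left, bipartite_left_right, bipartite_right_left,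
    bipartite_right_right, zero_mul, Finset.sum_const_zero, zero_add, add_zero] at h
  have h2 : ∑ a, ∑ b, W b a / Real.sqrt N * m (Fin.natAdd N a) * m (Fin.castAdd N b)
      = ∑ a, ∑ b, W a b / Real.sqrt N * m (Fin.castAdd N a) * m (Fin.natAdd N b) := by
    rw [Finset.sum_comm]
    exact Finset.sum_congr rfl fun a _ => Finset.sum_congr rfl fun b _ => by ring
  have h3 : ∑ a, m (Fin.castAdd N a) * ((∑ b, W a b * m (Fin.natAdd N b)) / Real.sqrt N)
      = ∑ a, ∑ b, W a b / Real.sqrt N * m (Fin.castAdd N a) * m (Fin.natAdd N b) := by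
    refine Finset.sum_congr rfl fun a _ => ?_
    rw [Finset.sum_div, Finset.mul_sum]
    exact Finset.sum_congr rfl fun b _ => by ring
  rw [h3]
  linarith

variable {W}

/-- Hadamard couplings lie exactly at the mean-field threshold. -/
theorem energy_bipartite_le (hW : W.IsHadamard) (hN : 0 < N) (m : Fin (N + N) → ℝ) :
    energy (bipartite W) m ≤ (∑ i, m i ^ 2) / 2 := by
  have hN' : (0 : ℝ) < N := by exact_mod_cast hN
  rw [energy_bipartite, Fin.sum_univ_add]
  have h1 : ∑ a, ((∑ b, W a b * m (Fin.natAdd N b)) / Real.sqrt N) ^ 2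
      = ∑ b, m (Fin.natAdd N b) ^ 2 := by
    simp only [div_pow, Real.sq_sqrt hN'.le, ← Finset.sum_div]
    rw [sum_hadamard_mulVec_sq hW, mul_div_cancel_left₀ _ hN'.ne']
  rw [← h1, ← Finset.sum_add_distrib, Finset.sum_div]
  exact Finset.sum_le_sum fun a _ => by
    have := two_mul_le_add_sq (m (Fin.castAdd N a))
      ((∑ b, W a b * m (Fin.natAdd N b)) / Real.sqrt N)
    linarith

/-- Each spin of the second half feels a field of variance `1` from the first half, which yields a
free energy gain of `1 / 2 - 1 / 4`. -/
theorem log_partition_bipartite_ge (hW : W.IsHadamard) (hN : 0 < N) :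
    (N + N : ℕ) * Real.log 2 + N / 4 ≤ Real.log (partition (bipartite W)) := by
  have hN' : (0 : ℝ) < N := by exact_mod_cast hN
  set S : Finset (Fin (N + N)) := Finset.univ.map (Fin.castAddEmb N) with hS
  have hmem : ∀ a, Fin.castAdd N a ∈ S := fun a =>
    Finset.mem_map.2 ⟨a, Finset.mem_univ _, rfl⟩
  have hSc : Sᶜ = Finset.univ.map (Fin.natAddEmb N) := by
    ext i
    refine Fin.addCases (fun a => ?_) (fun a => ?_) i
    · simp [hS, Fin.ext_iff]; intro b; omega
    · simp [hS, Fin.ext_iff]; intro b; omega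
  have h := log_partition_ge (bipartite_symm W) (bipartite_diag W) S le_rfl fun m hm => by
    rw [energy_bipartite, zero_mul, neg_zero]
    exact (Finset.sum_eq_zero fun a _ => by rw [hm _ (hmem a), zero_mul]).ge
  have hvar : ∀ b, ∑ i ∈ S, bipartite W i (Fin.natAdd N b) ^ 2 = 1 := by
    intro b
    rw [hS, Finset.sum_map]
    simp only [Fin.coe_castAddEmb, bipartite_left_right, div_pow, hadamard_sq hW,
      Real.sq_sqrt hN'.le]
    simp [hN'.ne']
  rw [hSc, Finset.sum_map] at h
  simp only [Fin.natAddEmb_apply, hvar] at h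
  refine le_trans (le_of_eq ?_) h
  simp
  ring

/-- With Hadamard couplings of order `8 t`, no set of at most `t` conditionings makes the average
covariance smaller than `1 / (64 √t)`. -/
theorem sqrt_mul_avgCondCov_bipartite_ge (hW : W.IsHadamard) {t : ℕ} (htpos : 0 < t)
    (hNt : N = 8 * t) {T : Finset (Fin (N + N))} (hT : T.card ≤ t) :
    1 / 64 ≤ Real.sqrt t * avgCondCov (isingGibbs (bipartite W)) T := by
  have hN0 : 0 < N := by omega
  have hT' : (T.card : ℝ) ≤ t := by exact_mod_cast hT
  have ht' : (0 : ℝ) < t := by exact_mod_cast htpos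
  have hNt' : (N : ℝ) = 8 * t := by exact_mod_cast hNt
  set r := Real.sqrt N with hr
  set s := Real.sqrt t with hs
  have hs0 : 0 < s := Real.sqrt_pos.2 ht'
  have hs2 : s ^ 2 = t := Real.sq_sqrt ht'.le
  have hr2 : r ^ 2 = 8 * t := by rw [hr, Real.sq_sqrt (by positivity), hNt']
  have hr0 : 0 < r := Real.sqrt_pos.2 (by rw [hNt']; positivity)
  have hrs : 2 * s ≤ r := by
    refine (pow_le_pow_iff_left₀ (by positivity) hr0.le two_ne_zero).1 ?_
    rw [mul_pow, hs2, hr2]; linarith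
  have hb : ∀ i j, |bipartite W i j| ≤ 1 / r := by
    have hW1 : ∀ a b, |W a b| = 1 := fun a b => by
      rw [← sq_eq_sq₀ (abs_nonneg _) zero_le_one, sq_abs, hadamard_sq hW, one_pow]
    have hr1 : 0 ≤ 1 / r := by positivity
    intro i j
    refine Fin.addCases (fun a => ?_) (fun a => ?_) i <;>
      refine Fin.addCases (fun b => ?_) (fun b => ?_) j
    · rwa [bipartite_left_left, abs_zero]
    · rw [bipartite_left_right, abs_div, hW1, abs_of_pos hr0]
    · rw [bipartite_right_left, abs_div, hW1, abs_of_pos hr0]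
    · rwa [bipartite_right_right, abs_zero]
  have h := avgCondCov_isingGibbs_ge (energy_bipartite_le hW hN0) hb (by omega) T
  have h2 := log_partition_bipartite_ge hW hN0
  set A := avgCondCov (isingGibbs (bipartite W)) T with hA
  have hA0 : 0 ≤ A := by
    refine div_nonneg (Finset.sum_nonneg fun p _ => Finset.sum_nonneg fun x _ =>
      mul_nonneg (isingGibbs_pos _ x).le (abs_nonneg _)) (Nat.cast_nonneg _)
  have hlog : T.card * Real.log 2 ≤ t * 0.7 := by
    have := Real.log_two_lt_d9
    have h0 := Real.log_pos one_lt_two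
    gcongr
    linarith
  have hchoose : ((N + N).choose 2 : ℝ) ≤ 128 * t ^ 2 := by
    rw [Nat.cast_choose_two]
    push_cast
    rw [hNt']
    nlinarith
  have h3 : 1.3 * t ≤ 128 * t ^ 2 * (1 / r) * A := by
    have : ((N + N).choose 2 : ℝ) * (1 / r) * A ≤ 128 * t ^ 2 * (1 / r) * A := by gcongr
    linarith
  have h4 : 1.3 * t * r ≤ 128 * t ^ 2 * A := by
    have := mul_le_mul_of_nonneg_right h3 hr0.le
    field_simp at this ⊢
    linarith
  have h5 : 1.3 * r ≤ 128 * t * A := by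
    refine le_of_mul_le_mul_left ?_ ht'
    linarith
  rw [← hs2] at h5
  have h6 : s * 2.6 ≤ s * (128 * (s * A)) := by nlinarith
  have := le_of_mul_le_mul_left h6 hs0
  linarith

end Bipartite

/-- For arbitrarily large `t` some distribution keeps its average covariance above `1 / (64 √t)`
whatever set of at most `t` conditionings is chosen. -/
theorem exists_sqrt_mul_avgCondCov_ge (k : ℕ) :
    ∃ n, 2 ^ k ≤ n ∧ ∃ μ ∈ stdSimplex ℝ (Cube n), ∀ T : Finset (Fin n), T.card ≤ 2 ^ k →
      1 / 64 ≤ Real.sqrt (2 ^ k : ℕ) * avgCondCov μ T := by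
  obtain ⟨W, hW⟩ := exists_isHadamard_two_pow (k + 3)
  exact ⟨_, (Nat.pow_le_pow_right two_pos (by omega)).trans (Nat.le_add_right _ (2 ^ (k + 3))),
    isingGibbs (bipartite W), isingGibbs_mem_stdSimplex _, fun T hT =>
      sqrt_mul_avgCondCov_bipartite_ge hW (by positivity) (by rw [pow_add]; ring) hT⟩

/-! ### The norm of a random sign matrix -/

/-- The symmetric matrix with zero diagonal and signs `J` off the diagonal. -/
def signMatrix {n : ℕ} (J : Pair n → ℤˣ) (i j : Fin n) : ℝ :=
  if h : i < j then ((J ⟨(i, j), h⟩ : ℤ) : ℝ)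
  else if h : j < i then ((J ⟨(j, i), h⟩ : ℤ) : ℝ) else 0

theorem signMatrix_pair {n : ℕ} (J : Pair n → ℤˣ) (p : Pair n) :
    signMatrix J p.1.1 p.1.2 = ((J p : ℤ) : ℝ) := by
  simp [signMatrix, p.2]

theorem signMatrix_symm {n : ℕ} (J : Pair n → ℤˣ) (i j : Fin n) :
    signMatrix J i j = signMatrix J j i := by
  unfold signMatrix
  rcases lt_trichotomy i j with h | h | h
  · simp [h, h.not_gt]
  · simp [h]
  · simp [h, h.not_gt]

theorem signMatrix_diag {n : ℕ} (J : Pair n → ℤˣ) (i : Fin n) : signMatrix J i i = 0 := by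
  simp [signMatrix]

theorem signMatrix_sq {n : ℕ} (J : Pair n → ℤˣ) {i j : Fin n} (h : i ≠ j) :
    signMatrix J i j ^ 2 = 1 := by
  have hu : ∀ u : ℤˣ, (((u : ℤˣ) : ℤ) : ℝ) ^ 2 = 1 := fun u => by
    rcases Int.units_eq_one_or u with h | h <;> simp [h]
  unfold signMatrix
  rcases h.lt_or_gt with h | h
  · rw [dif_pos h, hu]
  · rw [dif_neg h.not_gt, dif_pos h, hu]

/-- Chernoff bound for a fixed quadratic form with random signs. -/
theorem card_le_energy_signMatrix {n : ℕ} (v : Fin n → ℝ) (θ s : ℝ) :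
    ((Finset.univ.filter fun J : Pair n → ℤˣ => s ≤ θ * energy (signMatrix J) v).card : ℝ)
      ≤ 2 ^ Fintype.card (Pair n) * Real.exp (θ ^ 2 * (∑ i, v i ^ 2) ^ 2 / 4 - s) := by
  have h1 : ∑ J : Pair n → ℤˣ, Real.exp (θ * energy (signMatrix J) v)
      ≤ 2 ^ Fintype.card (Pair n) * Real.exp (θ ^ 2 * (∑ i, v i ^ 2) ^ 2 / 4) := by
    have h2 : ∀ J : Pair n → ℤˣ, Real.exp (θ * energy (signMatrix J) v)
        = ∏ p : Pair n, Real.exp (θ * (v p.1.1 * v p.1.2) * ((J p : ℤ) : ℝ)) := by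
      intro J
      rw [← Real.exp_sum]
      congr 1
      rw [energy, Finset.mul_sum]
      exact Finset.sum_congr rfl fun p _ => by rw [signMatrix_pair]; ring
    simp only [h2]
    rw [sum_prod_units fun (p : Pair n) (u : ℤˣ) =>
      Real.exp (θ * (v p.1.1 * v p.1.2) * ((u : ℤ) : ℝ))]
    have h3 : ∀ p : Pair n, Real.exp (θ * (v p.1.1 * v p.1.2) * (((1 : ℤˣ) : ℤ) : ℝ))
        + Real.exp (θ * (v p.1.1 * v p.1.2) * (((-1 : ℤˣ) : ℤ) : ℝ))
        ≤ 2 * Real.exp (θ ^ 2 / 2 * (v p.1.1 ^ 2 * v p.1.2 ^ 2)) := by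
      intro p
      have := Real.cosh_le_exp_half_sq (θ * (v p.1.1 * v p.1.2))
      rw [Real.cosh_eq] at this
      simp only [Units.val_one, Int.cast_one, mul_one, Units.val_neg, Int.cast_neg, mul_neg]
      rw [show θ ^ 2 / 2 * (v p.1.1 ^ 2 * v p.1.2 ^ 2) = (θ * (v p.1.1 * v p.1.2)) ^ 2 / 2 by ring]
      linarith
    refine (Finset.prod_le_prod (fun p _ => by positivity) fun p _ => h3 p).trans ?_
    rw [Finset.prod_mul_distrib, Finset.prod_const, Finset.card_univ, ← Real.exp_sum,
      ← Finset.mul_sum]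
    have h4 : 2 * ∑ p : Pair n, v p.1.1 ^ 2 * v p.1.2 ^ 2 ≤ (∑ i, v i ^ 2) ^ 2 := by
      have h5 : ∑ p : Pair n, v p.1.1 ^ 2 * v p.1.2 ^ 2
          = ∑ p : Pair n, if p.1.1 = p.1.2 then 0 else v p.1.1 ^ 2 * v p.1.2 ^ 2 :=
        Finset.sum_congr rfl fun p _ => by rw [if_neg p.2.ne]
      rw [h5, two_mul_sum_pair (fun i j => if i = j then 0 else v i ^ 2 * v j ^ 2)
        (fun i j => by simp only [eq_comm, mul_comm]) fun i => by simp, sq, Finset.sum_mul_sum]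
      refine Finset.sum_le_sum fun i _ => Finset.sum_le_sum fun j _ => ?_
      split_ifs
      · positivity
      · exact le_rfl
    have h6 := mul_le_mul_of_nonneg_left h4 (sq_nonneg θ)
    gcongr
    linarith
  rw [Real.exp_sub, ← mul_div_assoc, le_div_iff₀ (Real.exp_pos _)]
  refine le_trans ?_ h1
  rw [← nsmul_eq_mul, ← Finset.sum_const]
  refine (Finset.sum_le_sum fun J hJ => ?_).trans
    (Finset.sum_le_sum_of_subset_of_nonneg (Finset.filter_subset _ _) fun J _ _ =>
      (Real.exp_pos _).le)
  exact Real.exp_le_exp.2 (Finset.mem_filter.1 hJ).2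

/-- The integer points of squared length at most `4 n`; they serve as a net in `ℝⁿ`. -/
def intNet (n : ℕ) : Finset (Fin n → ℤ) :=
  (Fintype.piFinset fun _ => Finset.Icc (-(4 * n : ℤ)) (4 * n)).filter
    fun v => ∑ i, v i ^ 2 ≤ 4 * n

theorem mem_intNet {n : ℕ} {v : Fin n → ℤ} (h : ∑ i, v i ^ 2 ≤ 4 * n) : v ∈ intNet n := by
  refine Finset.mem_filter.2 ⟨Fintype.mem_piFinset.2 fun i => Finset.mem_Icc.2 ?_, h⟩
  have h1 : v i ^ 2 ≤ 4 * n :=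
    (Finset.single_le_sum (fun j _ => sq_nonneg (v j)) (Finset.mem_univ i)).trans h
  constructor <;> nlinarith

theorem sum_half_pow_natAbs_le (M : ℕ) :
    ∑ k ∈ Finset.Icc (-(M : ℤ)) M, (1 / 2 : ℝ) ^ k.natAbs = 3 - 2 * (1 / 2) ^ M := by
  induction M with
  | zero => norm_num
  | succ M ih =>
    have h : Finset.Icc (-((M + 1 : ℕ) : ℤ)) ((M + 1 : ℕ) : ℤ)
        = insert (-((M + 1 : ℕ) : ℤ)) (insert ((M + 1 : ℕ) : ℤ) (Finset.Icc (-(M : ℤ)) M)) := by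
      ext k
      simp only [Finset.mem_Icc, Finset.mem_insert]
      omega
    rw [h, Finset.sum_insert, Finset.sum_insert, ih, Int.natAbs_neg, Int.natAbs_natCast]
    · ring
    · simp
    · simp only [Finset.mem_Icc, Finset.mem_insert]
      omega

/-- Every point of the net has `ℓ¹` norm at most `4 n`, so weighting by `(1 / 2) ^ ‖v‖₁` reduces the
count to a product of geometric series. -/
theorem card_intNet_le (n : ℕ) : ((intNet n).card : ℝ) ≤ 48 ^ n := by
  calc ((intNet n).card : ℝ) = ∑ v ∈ intNet n, (1 : ℝ) := by simp
    _ ≤ ∑ v ∈ intNet n, 16 ^ n * ∏ i, (1 / 2 : ℝ) ^ (v i).natAbs := by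
        refine Finset.sum_le_sum fun v hv => ?_
        have h1 : ∑ i, (v i).natAbs ≤ 4 * n := by
          have h2 : ∑ i, ((v i).natAbs : ℤ) ≤ ∑ i, v i ^ 2 := Finset.sum_le_sum fun i _ => by
            rw [Int.natCast_natAbs, ← sq_abs]
            rcases (abs_nonneg (v i)).eq_or_lt with h | h
            · rw [← h]; norm_num
            · nlinarith
          exact_mod_cast h2.trans (Finset.mem_filter.1 hv).2
        rw [Finset.prod_pow_eq_pow_sum, one_div, inv_pow, ← div_eq_mul_inv,
          one_le_div (by positivity)]
        calc (2 : ℝ) ^ ∑ i, (v i).natAbs ≤ 2 ^ (4 * n) := pow_le_pow_right₀ one_le_two h1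
          _ = 16 ^ n := by rw [pow_mul]; norm_num
    _ ≤ ∑ v ∈ Fintype.piFinset fun _ : Fin n => Finset.Icc (-((4 * n : ℕ) : ℤ)) ((4 * n : ℕ) : ℤ),
          16 ^ n * ∏ i, (1 / 2 : ℝ) ^ (v i).natAbs := by
        refine Finset.sum_le_sum_of_subset_of_nonneg ?_ fun v _ _ => by positivity
        push_cast
        exact Finset.filter_subset _ _
    _ = 16 ^ n * (3 - 2 * (1 / 2) ^ (4 * n)) ^ n := by
        rw [← Finset.mul_sum,
          Finset.sum_prod_piFinset _ fun (_ : Fin n) (k : ℤ) => (1 / 2 : ℝ) ^ k.natAbs]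
        simp only [sum_half_pow_natAbs_le, Finset.prod_const, Finset.card_univ, Fintype.card_fin]
    _ ≤ 16 ^ n * 3 ^ n := by
        have h1 : (1 / 2 : ℝ) ^ (4 * n) ≤ 1 := pow_le_one₀ (by norm_num) (by norm_num)
        have h2 : (0 : ℝ) < (1 / 2) ^ (4 * n) := by positivity
        gcongr <;> linarith
    _ = 48 ^ n := by rw [← mul_pow]; norm_num

/-- The quadratic form of the sign matrix `J` is of the expected order on the integer net. The
constant `10` beats the cardinality of the net: `48 * exp (4 - 10) < 1 / 8`. -/
def NetBounded {n : ℕ} (J : Pair n → ℤˣ) : Prop :=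
  ∀ v ∈ intNet n, |energy (signMatrix J) fun i => (v i : ℝ)| ≤ 10 * (n * Real.sqrt n)

/-- All but an exponentially small fraction of the sign matrices are bounded on the net. -/
theorem card_not_netBounded_le {n : ℕ} (hn : 0 < n) :
    (Nat.card {J : Pair n → ℤˣ // ¬ NetBounded J} : ℝ)
      ≤ 2 ^ Fintype.card (Pair n) * (2 * (1 / 8) ^ n) := by
  classical
  have hn' : (0 : ℝ) < n := by exact_mod_cast hn
  have hs : 0 < Real.sqrt n := Real.sqrt_pos.2 hn'
  set bad : ℝ → (Fin n → ℤ) → Finset (Pair n → ℤˣ) := fun θ v =>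
    Finset.univ.filter fun J => 10 * n ≤ θ * energy (signMatrix J) fun i => (v i : ℝ) with hbad
  have hcard : ∀ θ : ℝ, θ ^ 2 = 1 / n → ∀ v ∈ intNet n,
      ((bad θ v).card : ℝ) ≤ 2 ^ Fintype.card (Pair n) * Real.exp (-6) ^ n := by
    intro θ hθ v hv
    refine (card_le_energy_signMatrix _ _ _).trans ?_
    rw [← Real.exp_nat_mul]
    have h1 : ∑ i, (v i : ℝ) ^ 2 ≤ 4 * n := by exact_mod_cast (Finset.mem_filter.1 hv).2
    have h2 : (∑ i, (v i : ℝ) ^ 2) ^ 2 ≤ (4 * n) ^ 2 :=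
      pow_le_pow_left₀ (Finset.sum_nonneg fun i _ => sq_nonneg _) h1 2
    have h3 : θ ^ 2 * (∑ i, (v i : ℝ) ^ 2) ^ 2 / 4 ≤ 4 * n := by
      calc θ ^ 2 * (∑ i, (v i : ℝ) ^ 2) ^ 2 / 4 ≤ 1 / (n : ℝ) * (4 * (n : ℝ)) ^ 2 / 4 := by
            rw [hθ]; gcongr
        _ = 4 * (n : ℝ) := by field_simp
    gcongr
    linarith
  have hsub : (Finset.univ.filter fun J : Pair n → ℤˣ => ¬ NetBounded J)
      ⊆ (intNet n).biUnion fun v => bad (1 / Real.sqrt n) v ∪ bad (-(1 / Real.sqrt n)) v := by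
    intro J hJ
    simp only [Finset.mem_filter, Finset.mem_univ, true_and, NetBounded, not_forall, not_le] at hJ
    obtain ⟨v, hv, h⟩ := hJ
    refine Finset.mem_biUnion.2 ⟨v, hv, Finset.mem_union.2 ?_⟩
    simp only [hbad, Finset.mem_filter, Finset.mem_univ, true_and]
    have key : ∀ e : ℝ, 10 * (n * Real.sqrt n) < e → 10 * n ≤ 1 / Real.sqrt n * e := by
      intro e he
      rw [one_div, inv_mul_eq_div, le_div_iff₀ hs]
      linarith
    rcases lt_abs.1 h with h | h
    · exact Or.inl (key _ h)
    · right
      rw [neg_mul, ← mul_neg]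
      exact key _ h
  have hexp : 48 * Real.exp (-6) ≤ 1 / 8 := by
    have h1 : Real.exp 6 = Real.exp 1 ^ 6 := by rw [← Real.exp_nat_mul]; norm_num
    have h2 : (2.7 : ℝ) ^ 6 ≤ Real.exp 1 ^ 6 :=
      pow_le_pow_left₀ (by norm_num) (by have := Real.exp_one_gt_d9; linarith) 6
    rw [Real.exp_neg, h1, ← div_eq_mul_inv, div_le_iff₀ (by positivity)]
    norm_num at h2 ⊢
    linarith
  rw [Nat.card_eq_fintype_card, Fintype.card_subtype]
  have hsq : (1 / Real.sqrt n) ^ 2 = 1 / (n : ℝ) := by rw [div_pow, Real.sq_sqrt hn'.le, one_pow]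
  calc ((Finset.univ.filter fun J : Pair n → ℤˣ => ¬ NetBounded J).card : ℝ)
      ≤ ∑ v ∈ intNet n,
        (((bad (1 / Real.sqrt n) v).card : ℝ) + (bad (-(1 / Real.sqrt n)) v).card) := by
        refine le_trans (Nat.cast_le.2 ((Finset.card_le_card hsub).trans
          (Finset.card_biUnion_le.trans (Finset.sum_le_sum fun v _ => Finset.card_union_le _ _)))) ?_
        push_cast
        exact le_rfl
    _ ≤ ∑ v ∈ intNet n, 2 * (2 ^ Fintype.card (Pair n) * Real.exp (-6) ^ n) := by
        refine Finset.sum_le_sum fun v hv => ?_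
        rw [two_mul]
        exact add_le_add (hcard _ hsq v hv) (hcard _ (by rw [neg_sq, hsq]) v hv)
    _ ≤ 48 ^ n * (2 * (2 ^ Fintype.card (Pair n) * Real.exp (-6) ^ n)) := by
        rw [Finset.sum_const, nsmul_eq_mul]
        exact mul_le_mul_of_nonneg_right (card_intNet_le n) (by positivity)
    _ = 2 ^ Fintype.card (Pair n) * (2 * (48 * Real.exp (-6)) ^ n) := by rw [mul_pow]; ring
    _ ≤ _ := by gcongr

theorem signProb_le_one (n : ℕ) (E : (Pair n → ℤˣ) → Prop) : signProb n E ≤ 1 := by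
  unfold signProb
  refine div_le_one_of_le₀ ?_ (Nat.cast_nonneg _)
  exact_mod_cast Nat.card_le_card_of_injective _ Subtype.val_injective

theorem signProb_ge_of_netBounded {n : ℕ} (hn : 0 < n) {E : (Pair n → ℤˣ) → Prop}
    (hE : ∀ J, NetBounded J → E J) : 1 - 2 * (1 / 8) ^ n ≤ signProb n E := by
  classical
  have h1 := card_not_netBounded_le hn
  have hcard : (Nat.card (Pair n → ℤˣ) : ℝ) = 2 ^ Fintype.card (Pair n) := by
    simp [Nat.card_eq_fintype_card]
  have h2 : (Nat.card (Pair n → ℤˣ) : ℝ)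
      ≤ Nat.card {J // E J} + Nat.card {J : Pair n → ℤˣ // ¬ NetBounded J} := by
    simp only [Nat.card_eq_fintype_card, Fintype.card_subtype]
    rw [← Finset.card_univ]
    norm_cast
    refine le_trans (Finset.card_le_card fun J _ => ?_) (Finset.card_union_le _ _)
    by_cases h : NetBounded J
    · exact Finset.mem_union_left _ (by simpa using hE J h)
    · exact Finset.mem_union_right _ (by simpa using h)
  unfold signProb
  rw [le_div_iff₀ (by rw [hcard]; positivity), hcard]
  rw [hcard] at h2
  linarith

/-- A function that is affine in each coordinate does not decrease under a suitable rounding of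
all coordinates to integers. -/
theorem exists_int_rounding {n : ℕ} (f : (Fin n → ℝ) → ℝ)
    (hf : ∀ m a, ∃ c d, ∀ s, f (Function.update m a s) = c + d * s) (m : Fin n → ℝ) :
    ∃ v : Fin n → ℤ, (∀ i, |(v i : ℝ) - m i| ≤ 1) ∧ f m ≤ f fun i => (v i : ℝ) := by
  have key : ∀ A : Finset (Fin n), ∃ w : Fin n → ℝ,
      (∀ i ∈ A, ∃ k : ℤ, w i = k ∧ |(k : ℝ) - m i| ≤ 1) ∧ (∀ i ∉ A, w i = m i) ∧ f m ≤ f w := by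
    intro A
    induction A using Finset.induction_on with
    | empty => exact ⟨m, by simp, by simp, le_rfl⟩
    | insert a A ha ih =>
      obtain ⟨w, h1, h2, h3⟩ := ih
      obtain ⟨c, d, hcd⟩ := hf w a
      have hw : f w = c + d * m a := by
        rw [← hcd, ← h2 a ha, Function.update_eq_self]
      -- move the coordinate in the direction in which the affine function does not decrease
      obtain ⟨k, hk1, hk2⟩ : ∃ k : ℤ, |(k : ℝ) - m a| ≤ 1 ∧ d * m a ≤ d * k := by
        rcases le_total 0 d with hd | hd
        · refine ⟨⌈m a⌉, ?_, mul_le_mul_of_nonneg_left (Int.le_ceil _) hd⟩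
          rw [abs_le]
          constructor <;> linarith [Int.le_ceil (m a), Int.ceil_lt_add_one (m a)]
        · refine ⟨⌊m a⌋, ?_, mul_le_mul_of_nonpos_left (Int.floor_le _) hd⟩
          rw [abs_le]
          constructor <;> linarith [Int.floor_le (m a), Int.lt_floor_add_one (m a)]
      refine ⟨Function.update w a k, fun i hi => ?_, fun i hi => ?_, ?_⟩
      · rcases eq_or_ne i a with rfl | hia
        · exact ⟨k, by simp, hk1⟩
        · rw [Function.update_of_ne hia]
          exact h1 i ((Finset.mem_insert.1 hi).resolve_left hia)
      · rw [Finset.mem_insert, not_or] at hi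
        rw [Function.update_of_ne hi.1, h2 i hi.2]
      · rw [hcd]
        linarith
  obtain ⟨w, h1, -, h3⟩ := key Finset.univ
  choose v hv using fun i => h1 i (Finset.mem_univ i)
  refine ⟨v, fun i => (hv i).2, ?_⟩
  rwa [← show w = fun i => (v i : ℝ) from funext fun i => (hv i).1]

theorem energy_update {n : ℕ} (B : Fin n → Fin n → ℝ) (m : Fin n → ℝ) (a : Fin n) :
    ∃ c d, ∀ s, energy B (Function.update m a s) = c + d * s := by
  refine ⟨energy B (Function.update m a 0),
    energy B (Function.update m a 1) - energy B (Function.update m a 0), fun s => ?_⟩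
  unfold energy
  rw [← Finset.sum_sub_distrib, Finset.sum_mul, ← Finset.sum_add_distrib]
  refine Finset.sum_congr rfl fun p _ => ?_
  by_cases h : p.1.1 = a
  · have h' : p.1.2 ≠ a := fun h' => p.2.ne (h.trans h'.symm)
    simp only [h, Function.update_self, Function.update_of_ne h']
    ring
  · by_cases h' : p.1.2 = a
    · simp only [h', Function.update_self, Function.update_of_ne h]
      ring
    · simp only [Function.update_of_ne h', Function.update_of_ne h]
      ring

/-- A bound on the net gives an operator norm bound of the right order `√n`. -/
theorem NetBounded.abs_energy_le {n : ℕ} (hn : 0 < n) {J : Pair n → ℤˣ} (hJ : NetBounded J)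
    (m : Fin n → ℝ) : |energy (signMatrix J) m| ≤ 10 * Real.sqrt n * ∑ i, m i ^ 2 := by
  have hn' : (0 : ℝ) < n := by exact_mod_cast hn
  have hnet : ∀ (m : Fin n → ℝ) (v : Fin n → ℤ), ∑ i, m i ^ 2 = n →
      (∀ i, |(v i : ℝ) - m i| ≤ 1) → v ∈ intNet n := by
    intro m v hm hv
    have h1 : ∀ i, (v i : ℝ) ^ 2 ≤ 2 * m i ^ 2 + 2 := fun i => by
      have h2 := (sq_le_one_iff_abs_le_one _).2 (hv i)
      nlinarith [sq_nonneg ((v i : ℝ) - 2 * m i)]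
    have h3 : ∑ i, (v i : ℝ) ^ 2 ≤ 4 * n := by
      refine (Finset.sum_le_sum fun i _ => h1 i).trans_eq ?_
      rw [Finset.sum_add_distrib, ← Finset.mul_sum, hm]
      simp
      ring
    exact mem_intNet (by exact_mod_cast h3)
  have hsphere : ∀ m : Fin n → ℝ, ∑ i, m i ^ 2 = n →
      |energy (signMatrix J) m| ≤ 10 * (n * Real.sqrt n) := by
    intro m hm
    refine abs_le'.2 ⟨?_, ?_⟩
    · obtain ⟨v, hv, h⟩ := exists_int_rounding _ (energy_update (signMatrix J)) m
      exact h.trans ((le_abs_self _).trans (hJ v (hnet m v hm hv)))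
    · obtain ⟨v, hv, h⟩ := exists_int_rounding (fun m => -energy (signMatrix J) m)
        (fun m a => by
          obtain ⟨c, d, h⟩ := energy_update (signMatrix J) m a
          exact ⟨-c, -d, fun s => by rw [h]; ring⟩) m
      exact h.trans ((neg_le_abs _).trans (hJ v (hnet m v hm hv)))
  rcases (Finset.sum_nonneg fun i (_ : i ∈ Finset.univ) => sq_nonneg (m i)).eq_or_lt with h | h
  · have h0 : ∀ i, m i = 0 := fun i => by
      have := (Finset.sum_eq_zero_iff_of_nonneg fun i _ => sq_nonneg (m i)).1 h.symm i
        (Finset.mem_univ i)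
      exact pow_eq_zero_iff two_ne_zero |>.1 this
    rw [← h]
    simp [energy, h0]
  · set q := ∑ i, m i ^ 2 with hq
    -- rescale `m` to squared length `n`
    set r := Real.sqrt (n / q) with hr
    have hr2 : r ^ 2 = n / q := Real.sq_sqrt (by positivity)
    have h1 := hsphere (fun i => r * m i) (by
      simp only [mul_pow, ← Finset.mul_sum]
      rw [hr2, ← hq, div_mul_cancel₀ _ h.ne'])
    rw [energy_smul, abs_mul, abs_of_nonneg (sq_nonneg r), hr2, div_mul_eq_mul_div,
      div_le_iff₀ h] at h1
    refine le_of_mul_le_mul_left ?_ hn'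
    linarith

/-! ### The Sherrington–Kirkpatrick model at high temperature -/

theorem skGibbs_eq_isingGibbs {n : ℕ} (β : ℝ) (J : Pair n → ℤˣ) :
    skGibbs β J = isingGibbs fun i j => β / Real.sqrt n * signMatrix J i j := by
  have h : ∀ x : Cube n, skWeight β J x
      = Real.exp (energy (fun i j => β / Real.sqrt n * signMatrix J i j) (spin x)) := by
    intro x
    rw [skWeight, energy, Finset.mul_sum]
    congr 1
    exact Finset.sum_congr rfl fun p _ => by rw [signMatrix_pair]; ring
  ext x
  simp only [skGibbs, isingGibbs, partition, h]

/-- The free energy gain of the Sherrington–Kirkpatrick model at inverse temperature `1 / 40` is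
linear in `n`. -/
theorem log_partition_sk_ge {n : ℕ} (hn : 3 ≤ n) {J : Pair n → ℤˣ} (hJ : NetBounded J) :
    n * Real.log 2 + n / 76800
      ≤ Real.log (partition fun i j => 1 / 40 / Real.sqrt n * signMatrix J i j) := by
  have hn' : (0 : ℝ) < n := by positivity
  have hs : 0 < Real.sqrt n := Real.sqrt_pos.2 hn'
  set B : Fin n → Fin n → ℝ := fun i j => 1 / 40 / Real.sqrt n * signMatrix J i j with hB
  have hen : ∀ m, energy B m = 1 / 40 / Real.sqrt n * energy (signMatrix J) m := by
    intro m
    rw [energy, energy, Finset.mul_sum]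
    exact Finset.sum_congr rfl fun p _ => by simp only [hB]; ring
  -- the first half of the spins exerts a field of variance `q ≈ β² / 2` on the other half, with
  -- `β = 1 / 40`
  set S : Finset (Fin n) := Finset.univ.filter fun i => i.val < n / 2 with hS
  have hcard : S.card = n / 2 := by
    rw [hS, Fin.card_filter_val_lt]
    omega
  have h := log_partition_ge (B := B) (fun i j => by simp only [hB, signMatrix_symm J i j])
    (fun i => by simp [hB, signMatrix_diag]) S (ε := 1 / 4) (by norm_num) fun m _ => by
      rw [hen]
      have h1 := (abs_le.1 (hJ.abs_energy_le (by omega) m)).1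
      calc -(1 / 4 * ∑ i, m i ^ 2)
          = 1 / 40 / Real.sqrt n * -(10 * Real.sqrt n * ∑ i, m i ^ 2) := by field_simp; ring
        _ ≤ _ := mul_le_mul_of_nonneg_left h1 (by positivity)
  set q : ℝ := (n / 2 : ℕ) / (1600 * n) with hq
  have hvar : ∀ j ∈ Sᶜ, ∑ i ∈ S, B i j ^ 2 = q := by
    intro j hj
    have h1 : ∀ i ∈ S, B i j ^ 2 = 1 / (1600 * n) := by
      intro i hi
      simp only [hB]
      rw [mul_pow, signMatrix_sq J (ne_of_mem_of_not_mem hi (Finset.mem_compl.1 hj)), div_pow,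
        Real.sq_sqrt hn'.le]
      field_simp
      norm_num
    rw [Finset.sum_congr rfl h1, Finset.sum_const, hcard, nsmul_eq_mul, hq]
    ring
  rw [Finset.sum_congr rfl fun j hj => by rw [hvar j hj], Finset.sum_const, Finset.card_compl, hcard,
    nsmul_eq_mul, Fintype.card_fin] at h
  have hlo : (n : ℝ) / 3 ≤ (n / 2 : ℕ) := by
    have : n ≤ 3 * (n / 2) := by omega
    have : (n : ℝ) ≤ 3 * (n / 2 : ℕ) := by exact_mod_cast this
    linarith
  have hhi : (n : ℝ) / 2 ≤ (n - n / 2 : ℕ) := by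
    have : n ≤ 2 * (n - n / 2) := by omega
    have : (n : ℝ) ≤ 2 * (n - n / 2 : ℕ) := by exact_mod_cast this
    linarith
  have hup : ((n / 2 : ℕ) : ℝ) ≤ n := by exact_mod_cast Nat.div_le_self n 2
  have hq1 : 1 / 4800 ≤ q := by
    rw [hq, le_div_iff₀ (by positivity)]
    linarith
  have hq2 : q ≤ 1 / 1600 := by
    rw [hq, div_le_iff₀ (by positivity)]
    linarith
  have h2 : (1 / 38400 : ℝ) ≤ (1 / 2 - 1 / 4) * q - q ^ 2 / 4 := by nlinarith
  have h3 := mul_le_mul hhi h2 (by norm_num) (Nat.cast_nonneg _)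
  linarith

/-- If the sign matrix has norm of order `√n`, then at inverse temperature `1 / 40` a small linear
number of conditionings leaves the average covariance of order `1 / √n`. -/
theorem avgCondCov_sk_ge {n : ℕ} (hn : 3 ≤ n) {J : Pair n → ℤˣ} (hJ : NetBounded J)
    {T : Finset (Fin n)} (hT : T.card ≤ n / 128000) :
    1 / 2500 / Real.sqrt n ≤ avgCondCov (skGibbs (1 / 40) J) T := by
  have hn' : (0 : ℝ) < n := by positivity
  rw [skGibbs_eq_isingGibbs]
  set s := Real.sqrt n with hs
  have hs0 : 0 < s := Real.sqrt_pos.2 hn'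
  have hs2 : s ^ 2 = n := Real.sq_sqrt hn'.le
  set B : Fin n → Fin n → ℝ := fun i j => 1 / 40 / s * signMatrix J i j with hB
  have hMF : ∀ m, energy B m ≤ (∑ i, m i ^ 2) / 2 := by
    intro m
    have hen : energy B m = 1 / 40 / s * energy (signMatrix J) m := by
      rw [energy, energy, Finset.mul_sum]
      exact Finset.sum_congr rfl fun p _ => by simp only [hB]; ring
    have h1 := (le_abs_self _).trans (hJ.abs_energy_le (by omega) m)
    have h2 : 0 ≤ ∑ i, m i ^ 2 := Finset.sum_nonneg fun i _ => sq_nonneg _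
    rw [hen]
    calc 1 / 40 / s * energy (signMatrix J) m
        ≤ 1 / 40 / s * (10 * s * ∑ i, m i ^ 2) := mul_le_mul_of_nonneg_left h1 (by positivity)
      _ = (∑ i, m i ^ 2) / 4 := by field_simp; ring
      _ ≤ _ := by linarith
  have hb : ∀ i j, |B i j| ≤ 1 / 40 / s := by
    intro i j
    have h1 : |signMatrix J i j| ≤ 1 := by
      rcases eq_or_ne i j with rfl | h
      · simp [signMatrix_diag]
      · rw [← sq_le_one_iff_abs_le_one, signMatrix_sq J h]
    rw [hB, abs_mul, abs_of_nonneg (by positivity)]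
    exact mul_le_of_le_one_right (by positivity) h1
  have h1 := avgCondCov_isingGibbs_ge hMF hb (by omega) T
  have h2 := log_partition_sk_ge hn hJ
  set A := avgCondCov (isingGibbs B) T with hA
  have hT' : (T.card : ℝ) * Real.log 2 ≤ n / 128000 * 0.7 := by
    have h3 : (T.card : ℝ) ≤ n / 128000 :=
      (Nat.cast_le.2 hT).trans (by exact_mod_cast Nat.cast_div_le (α := ℝ) (m := n) (n := 128000))
    have h4 := Real.log_two_lt_d9
    have h5 := Real.log_pos one_lt_two
    exact mul_le_mul h3 (by linarith) h5.le (by positivity)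
  have hchoose : (n.choose 2 : ℝ) ≤ n ^ 2 / 2 := by
    rw [Nat.cast_choose_two]
    nlinarith
  have hA0 : 0 ≤ A :=
    div_nonneg (Finset.sum_nonneg fun p _ => Finset.sum_nonneg fun x _ =>
      mul_nonneg (isingGibbs_pos _ x).le (abs_nonneg _)) (Nat.cast_nonneg _)
  have h3 : (n.choose 2 : ℝ) * (1 / 40 / s) * A ≤ n ^ 2 / 2 * (1 / 40 / s) * A := by gcongr
  have h4 : (n : ℝ) / 200000 ≤ n ^ 2 / 2 * (1 / 40 / s) * A := by
    change _ ≤ Real.log (partition B) at h2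
    linarith
  have h5 : (n : ℝ) ^ 2 / 2 * (1 / 40 / s) * A = n * (s * A / 80) := by
    rw [← hs2]
    field_simp
    ring
  rw [h5, div_eq_mul_one_div] at h4
  have h6 := le_of_mul_le_mul_left h4 hn'
  rw [div_le_iff₀ hs0]
  linarith

/-- With high probability over the disorder, a linear number `t` of conditionings leaves an average
covariance of order `1 / √t` in the Sherrington–Kirkpatrick model. -/
theorem exists_sk_avgCondCov_ge :
    ∃ (β C : ℝ) (t : ℕ → ℕ), 0 < β ∧ β < 1 / 2 ∧ 0 < C ∧ Tendsto t atTop atTop ∧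
      Tendsto (fun n : ℕ => signProb n fun J => ∀ T : Finset (Fin n), T.card ≤ t n →
        C / Real.sqrt (t n) ≤ avgCondCov (skGibbs β J) T) atTop (𝓝 1) := by
  -- `1 / 1280000 = 1 / 2500 * (1 / 512)`, where `√t ≥ √n / 512`
  refine ⟨1 / 40, 1 / 1280000, fun n => n / 128000, by norm_num, by norm_num, by norm_num,
    Nat.tendsto_div_const_atTop (by norm_num), ?_⟩
  have hlim : Tendsto (fun n : ℕ => 1 - 2 * (1 / 8 : ℝ) ^ n) atTop (𝓝 1) := by
    have := (tendsto_pow_atTop_nhds_zero_of_lt_one (r := (1 / 8 : ℝ)) (by norm_num)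
      (by norm_num)).const_mul 2 |>.const_sub 1
    simpa using this
  refine tendsto_of_tendsto_of_tendsto_of_le_of_le' hlim tendsto_const_nhds ?_
    (Eventually.of_forall fun n => signProb_le_one n _)
  filter_upwards [eventually_ge_atTop 128000] with n hn
  refine signProb_ge_of_netBounded (by omega) fun J hJ T hT => ?_
  refine le_trans ?_ (avgCondCov_sk_ge (by omega) hJ hT)
  have hn' : (0 : ℝ) < n := by positivity
  have hs0 : 0 < Real.sqrt n := Real.sqrt_pos.2 hn'
  have ht : (n : ℝ) / 512 ^ 2 ≤ (n / 128000 : ℕ) := by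
    have : n ≤ 512 ^ 2 * (n / 128000) := by omega
    have : (n : ℝ) ≤ 512 ^ 2 * (n / 128000 : ℕ) := by exact_mod_cast this
    linarith
  have hr : Real.sqrt n / 512 ≤ Real.sqrt (n / 128000 : ℕ) := by
    refine Real.le_sqrt_of_sq_le ?_
    rwa [div_pow, Real.sq_sqrt hn'.le]
  calc 1 / 1280000 / Real.sqrt (n / 128000 : ℕ) ≤ 1 / 1280000 / (Real.sqrt n / 512) := by gcongr
    _ = 1 / 2500 / Real.sqrt n := by field_simp; norm_num

/-! ### Lower bounds for correlation rounding -/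

theorem le_kappaStar : ENNReal.ofReal (1 / (16 * Real.sqrt 27)) ≤ kappaStar := by
  have h1 : 1 / (16 * Real.sqrt 27) ≤ 1 / 64 := by
    have : (4 : ℝ) ≤ Real.sqrt 27 := Real.le_sqrt_of_sq_le (by norm_num)
    exact one_div_le_one_div_of_le (by norm_num) (by linarith)
  refine (ENNReal.ofReal_le_ofReal h1).trans (le_limsup_of_frequently_le' ?_)
  refine frequently_atTop.2 fun k => ⟨2 ^ k, k.lt_two_pow_self.le, ?_⟩
  obtain ⟨n, hn, μ, hμ, h⟩ := exists_sqrt_mul_avgCondCov_ge k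
  refine le_iSup_of_le n (le_iSup_of_le hn (le_iSup_of_le μ (le_iSup_of_le hμ ?_)))
  exact le_iInf fun S => le_iInf fun hS => ENNReal.ofReal_le_ofReal (h S hS)

theorem not_correlationRoundingWithin_of_isLittleO {g : ℝ → ℝ}
    (hg : g =o[𝓝[>] 0] fun ε => 1 / ε ^ 2) : ¬ CorrelationRoundingWithin g := by
  intro hround
  -- for `t = 2 ^ k` take half of the least possible covariance as accuracy, `ε = 1 / (128 √t)`;
  -- then `g ε ≤ t` for large `k`
  have hlim : Tendsto (fun k : ℕ => 1 / 128 / Real.sqrt (2 ^ k : ℕ)) atTop (𝓝[>] 0) := by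
    refine tendsto_nhdsWithin_iff.2 ⟨?_, Eventually.of_forall fun k => ?_⟩
    · refine Tendsto.div_atTop tendsto_const_nhds (Real.tendsto_sqrt_atTop.comp ?_)
      exact tendsto_natCast_atTop_atTop.comp
        (tendsto_pow_atTop_atTop_of_one_lt one_lt_two)
    · have : (0 : ℝ) < (2 ^ k : ℕ) := by positivity
      have := Real.sqrt_pos.2 this
      exact Set.mem_Ioi.2 (by positivity)
  obtain ⟨k, hk⟩ := (hlim.eventually (hg.bound (c := 1 / 128 ^ 2) (by norm_num))).exists
  obtain ⟨n, -, μ, hμ, h⟩ := exists_sqrt_mul_avgCondCov_ge k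
  have ht1 : (1 : ℝ) ≤ (2 ^ k : ℕ) := by exact_mod_cast Nat.one_le_two_pow
  have ht0 : (0 : ℝ) < (2 ^ k : ℕ) := by linarith
  set s := Real.sqrt (2 ^ k : ℕ) with hs
  have hs0 : 0 < s := Real.sqrt_pos.2 ht0
  have hs1 : 1 ≤ s := Real.one_le_sqrt.2 ht1
  have hs2 : s ^ 2 = (2 ^ k : ℕ) := Real.sq_sqrt ht0.le
  obtain ⟨t, htn, htg, hle⟩ := hround (1 / 128 / s) (by positivity)
    ((div_le_self (by norm_num) hs1).trans (by norm_num)) n μ hμ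
  have hgt : g (1 / 128 / s) ≤ (2 ^ k : ℕ) := by
    refine ((le_abs_self _).trans hk).trans_eq ?_
    rw [← hs2, Real.norm_of_nonneg (by positivity)]
    field_simp
  have htk : t ≤ 2 ^ k := by exact_mod_cast htg.trans hgt
  have hc : (0 : ℝ) < n.choose t := by exact_mod_cast Nat.choose_pos htn
  have hsum : (n.choose t : ℝ) * (1 / 64 / s)
      ≤ ∑ T ∈ Finset.powersetCard t (Finset.univ : Finset (Fin n)), avgCondCov μ T := by
    have h1 : ∀ T ∈ Finset.powersetCard t (Finset.univ : Finset (Fin n)),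
        1 / 64 / s ≤ avgCondCov μ T := fun T hT => by
      rw [div_le_iff₀ hs0, mul_comm]
      exact h T ((Finset.mem_powersetCard.1 hT).2.trans_le htk)
    have h2 := Finset.card_nsmul_le_sum _ _ _ h1
    rwa [Finset.card_powersetCard, Finset.card_univ, Fintype.card_fin, nsmul_eq_mul] at h2
  rw [div_le_iff₀ hc] at hle
  have h3 := hsum.trans hle
  rw [mul_comm] at h3
  have h4 := le_of_mul_le_mul_right h3 hc
  rw [div_le_div_iff_of_pos_right hs0] at h4
  norm_num at h4

/-- `K / ε` is `o(1 / ε²)`. -/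
theorem not_allenODonnellZhouConjecture : ¬ AllenODonnellZhouConjecture := by
  rintro ⟨K, hK⟩
  refine not_correlationRoundingWithin_of_isLittleO ?_ hK
  have h : (fun ε : ℝ => K * ε) =o[𝓝[>] 0] fun _ => (1 : ℝ) := by
    rw [isLittleO_one_iff]
    have : Tendsto (fun ε : ℝ => K * ε) (𝓝 0) (𝓝 (K * 0)) := tendsto_id.const_mul K
    rw [mul_zero] at this
    exact this.mono_left nhdsWithin_le_nhds
  have h2 := h.mul_isBigO (isBigO_refl (fun ε : ℝ => 1 / ε ^ 2) (𝓝[>] 0))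
  refine (h2.congr' ?_ (Eventually.of_forall fun ε => one_mul _))
  filter_upwards [self_mem_nhdsWithin] with ε hε
  have : ε ≠ 0 := (Set.mem_Ioi.1 hε).ne'
  field_simp

end CorrRounding

end

theorem mainTheorem3 :
    (∃ (β C : ℝ) (t : ℕ → ℕ), 0 < β ∧ β < 1 / 2 ∧ 0 < C ∧ Tendsto t atTop atTop ∧
      Tendsto (fun n : ℕ => CorrRounding.signProb n fun J =>
        ∀ T : Finset (Fin n), T.card ≤ t n →
          C / Real.sqrt (t n) ≤ CorrRounding.avgCondCov (CorrRounding.skGibbs β J) T)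
        atTop (𝓝 1)) ∧
    ENNReal.ofReal (1 / (16 * Real.sqrt 27)) ≤ CorrRounding.kappaStar ∧
    (∀ g : ℝ → ℝ, (g =o[𝓝[>] 0] fun ε => 1 / ε ^ 2) →
      ¬ CorrRounding.CorrelationRoundingWithin g) ∧
    ¬ CorrRounding.AllenODonnellZhouConjecture := by
  exact ⟨CorrRounding.exists_sk_avgCondCov_ge, CorrRounding.le_kappaStar,
    fun _ => CorrRounding.not_correlationRoundingWithin_of_isLittleO,
    CorrRounding.not_allenODonnellZhouConjecture⟩
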